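/- **Theorem 4.5.** Let $\alpha=(\alpha_n)_{n\ge 0}$ be an increasing (i.e. non-decreasing) sequence of strictly positive real numbers tending to infinity. Over the scalar field $\mathbb K=\mathbb R$ or $\mathbb C$, let $X$ be one of the power series spaces of infinite type $$\Lambda_{p,\infty}(\alpha)=\Big\{(x_n)_{n\ge 0}: \sum_{n\ge 0}|x_n|^p e^{t\alpha_n}<\infty \text{ for all } t\in\mathbb R\Big\}\quad(1\le p<\infty),$$ $$C_{0,\infty}(\alpha)=\Big\{(x_n)_{n\ge 0}: \lim_{n\to\infty}|x_n| e^{t\alpha_n}=0 \text{ for all } t\in\mathbb R\Big\},$$ with the topology generated by the seminorms $\big(\sum_n|x_n|^pe^{t\alpha_n}\big)^{1/p}$, respectively $\sup_n|x_n|e^{t\alpha_n}$, $t\in\mathbb R$. Suppose that either (1) in the case $X=\Lambda_{p,\infty}(\alpha)$: there is $\varepsilon\in(0,1)$ such that for every $C>0$ there is an integer $j\ge 1$ with $$\sum_{n\ge j}\varepsilon^{\alpha_{n-j}+\dots+\alpha_{n-1}-C\alpha_n}<\infty;$$ in the case $X=C_{0,\infty}(\alpha)$: for every $C>0$ there is an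 integer $j\ge 1$ with $$\liminf_{n\to\infty}\big(\alpha_{n-j}+\dots+\alpha_{n-1}-C\alpha_n\big)>-\infty;$$ or (2) $\displaystyle\lim_{n\to\infty}\frac{\alpha_{n+1}}{\alpha_n}=1$. Then $X$ supports a chaotic weighted shift, and there exists a frequently hypercyclic weighted shift on $X$ that is not chaotic. Here a weighted shift on $X$ is a continuous linear operator $B_w:X\to X$ of the form $B_w(x_n)_{n\ge0}=(w_{n+1}x_{n+1})_{n\ge0}$ with non-zero scalars $w_n$. An operator $T$ on $X$ is chaotic if it has a dense orbit and a dense set of periodic points. It is frequently hypercyclic if there is $x\in X$ such that for every non-empty open $U\subset X$ the set $A=\{n\ge 0: T^nx\in U\}$ has positive lower density, $\liminf_{N\to\infty}\frac{1}{N+1}\operatorname{card}\{n\le N: n\in A\}>0$. -/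

import Mathlib

open Filter Topology

noncomputable section

/-! ### Linear dynamics -/

/-- The lower (asymptotic) density `liminf_N card {n ≤ N : n ∈ A} / (N + 1)` of a set of
natural numbers. -/
def lowerDensity (A : Set ℕ) : ℝ :=
  liminf (fun N : ℕ => ((A ∩ Set.Iic N).ncard : ℝ) / ((N : ℝ) + 1)) atTop

/-- `f` has a dense orbit. -/
def IsHypercyclic {X : Type*} [TopologicalSpace X] (f : X → X) : Prop :=
  ∃ x : X, Dense (Set.range fun n : ℕ => f^[n] x)

/-- `f` has a dense orbit and a dense set of periodic points. -/
def IsChaotic {X : Type*} [TopologicalSpace X] (f : X → X) : Prop :=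
  IsHypercyclic f ∧ Dense (Function.periodicPts f)

/-- There is a point whose orbit visits every non-empty open set along a set of times of positive
lower density. -/
def IsFrequentlyHypercyclic {X : Type*} [TopologicalSpace X] (f : X → X) : Prop :=
  ∃ x : X, ∀ U : Set X, IsOpen U → U.Nonempty → 0 < lowerDensity {n : ℕ | f^[n] x ∈ U}

/-- The operator `T` on the sequence space `X` is the weighted (backward) shift
`(x_n)_{n ≥ 0} ↦ (w_{n+1} x_{n+1})_{n ≥ 0}` with the non-zero weights `w`. -/
def IsWeightedShift {𝕜 X : Type*} [RCLike 𝕜] [AddCommGroup X] [Module 𝕜 X] [TopologicalSpace X]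
    [FunLike X ℕ 𝕜] (T : X →L[𝕜] X) (w : ℕ → 𝕜) : Prop :=
  (∀ n, w n ≠ 0) ∧ ∀ (x : X) (n : ℕ), T x n = w (n + 1) * x (n + 1)

/-- The sequence space `X` supports a chaotic weighted shift. -/
def SupportsChaoticShift (𝕜 X : Type*) [RCLike 𝕜] [AddCommGroup X] [Module 𝕜 X]
    [TopologicalSpace X] [FunLike X ℕ 𝕜] : Prop :=
  ∃ (T : X →L[𝕜] X) (w : ℕ → 𝕜), IsWeightedShift T w ∧ IsChaotic T

/-- The sequence space `X` supports a frequently hypercyclic weighted shift that is not chaotic. -/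
def SupportsNonChaoticFHCShift (𝕜 X : Type*) [RCLike 𝕜] [AddCommGroup X] [Module 𝕜 X]
    [TopologicalSpace X] [FunLike X ℕ 𝕜] : Prop :=
  ∃ (T : X →L[𝕜] X) (w : ℕ → 𝕜),
    IsWeightedShift T w ∧ IsFrequentlyHypercyclic T ∧ ¬ IsChaotic T

/-- For `n ≥ j` this is `α_{n-j} + … + α_{n-1}`. -/
def windowSum (α : ℕ → ℝ) (j n : ℕ) : ℝ := ∑ i ∈ Finset.Ico (n - j) n, α i

/-! ### Power series spaces of order `p ∈ [1, ∞)` and infinite type -/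

theorem weighted_rpow_aux {p : ℝ} (hp : 1 ≤ p) {a : ℝ} (ha : 0 ≤ a) (s : ℝ) :
    (a * Real.exp (s / p)) ^ p = a ^ p * Real.exp s := by
  rw [Real.mul_rpow ha (Real.exp_pos _).le, ← Real.exp_mul, div_mul_cancel₀ _ (by linarith)]

theorem weighted_minkowski_aux {𝕜 : Type*} [RCLike 𝕜] {p : ℝ} (hp : 1 ≤ p) (s : ℕ → ℝ)
    {x y : ℕ → 𝕜} (hx : Summable fun n => ‖x n‖ ^ p * Real.exp (s n))
    (hy : Summable fun n => ‖y n‖ ^ p * Real.exp (s n)) :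
    (Summable fun n => ‖x n + y n‖ ^ p * Real.exp (s n)) ∧
      (∑' n, ‖x n + y n‖ ^ p * Real.exp (s n)) ^ (1 / p) ≤
        (∑' n, ‖x n‖ ^ p * Real.exp (s n)) ^ (1 / p) +
          (∑' n, ‖y n‖ ^ p * Real.exp (s n)) ^ (1 / p) := by
  have hp0 : 0 ≤ p := by linarith
  have key := Real.Lp_add_le_tsum_of_nonneg (f := fun n => ‖x n‖ * Real.exp (s n / p))
    (g := fun n => ‖y n‖ * Real.exp (s n / p)) hp (fun n => by positivity)
    (fun n => by positivity)
    (by simpa only [weighted_rpow_aux hp (norm_nonneg _)] using hx)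
    (by simpa only [weighted_rpow_aux hp (norm_nonneg _)] using hy)
  have hle : ∀ n, ‖x n + y n‖ ^ p * Real.exp (s n) ≤
      (‖x n‖ * Real.exp (s n / p) + ‖y n‖ * Real.exp (s n / p)) ^ p := by
    intro n
    rw [← add_mul, weighted_rpow_aux hp (by positivity)]
    gcongr
    exact norm_add_le _ _
  have hs := Summable.of_nonneg_of_le (fun n => by positivity) hle key.1
  refine ⟨hs, ?_⟩
  have h2 := key.2
  simp only [weighted_rpow_aux hp (norm_nonneg _)] at h2
  refine le_trans ?_ h2
  exact Real.rpow_le_rpow (tsum_nonneg fun n => by positivity)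
    (Summable.tsum_le_tsum hle hs key.1) (by positivity)

/-- The vector space of all sequences `x` with `∑ |x_n|^p e^{t α_n} < ∞` for all real `t`. -/
def LambdaSubmodule (𝕜 : Type*) [RCLike 𝕜] (p : ℝ) [hp : Fact (1 ≤ p)] (α : ℕ → ℝ) :
    Submodule 𝕜 (ℕ → 𝕜) where
  carrier := {x | ∀ t : ℝ, Summable fun n => ‖x n‖ ^ p * Real.exp (t * α n)}
  zero_mem' := fun t => by
    have h : p ≠ 0 := by linarith [hp.out]
    simp [Real.zero_rpow h]
  add_mem' := fun hx hy t => (weighted_minkowski_aux hp.out _ (hx t) (hy t)).1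
  smul_mem' := fun c x hx t => by
    have := (hx t).mul_left (‖c‖ ^ p)
    simpa [Real.mul_rpow (norm_nonneg _) (norm_nonneg _), mul_assoc] using this

/-- The power series space `Λ_{p,∞}(α)`. It is a type of its own, so that it does not carry the
topology of coordinatewise convergence. -/
def Lambda (𝕜 : Type*) [RCLike 𝕜] (p : ℝ) [Fact (1 ≤ p)] (α : ℕ → ℝ) : Type _ :=
  ↥(LambdaSubmodule 𝕜 p α)

namespace Lambda

variable {𝕜 : Type*} [RCLike 𝕜] {p : ℝ} [hp : Fact (1 ≤ p)] {α : ℕ → ℝ}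

instance : AddCommGroup (Lambda 𝕜 p α) := inferInstanceAs (AddCommGroup ↥(LambdaSubmodule 𝕜 p α))

instance : Module 𝕜 (Lambda 𝕜 p α) := inferInstanceAs (Module 𝕜 ↥(LambdaSubmodule 𝕜 p α))

instance : FunLike (Lambda 𝕜 p α) ℕ 𝕜 where
  coe x := x.1
  coe_injective := Subtype.coe_injective

/-- The seminorm `(∑ |x_n|^p e^{t α_n})^{1/p}`. -/
def seminorm (t : ℝ) : Seminorm 𝕜 (Lambda 𝕜 p α) :=
  Seminorm.of (fun x => (∑' n, ‖x n‖ ^ p * Real.exp (t * α n)) ^ (1 / p))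
    (fun x y => (weighted_minkowski_aux hp.out (fun n => t * α n) (x.2 t) (y.2 t)).2)
    (fun c x => by
      have hp0 : p ≠ 0 := by linarith [hp.out]
      have h : ∀ n, ‖(c • x : Lambda 𝕜 p α) n‖ ^ p * Real.exp (t * α n) =
          ‖c‖ ^ p * (‖x n‖ ^ p * Real.exp (t * α n)) := fun n => by
        have h1 : (c • x : Lambda 𝕜 p α) n = c * x n := rfl
        rw [h1, norm_mul, Real.mul_rpow (norm_nonneg _) (norm_nonneg _), mul_assoc]
      simp only [h]
      rw [tsum_mul_left, Real.mul_rpow (by positivity) (tsum_nonneg fun n => by positivity),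
        ← Real.rpow_mul (norm_nonneg _), mul_one_div_cancel hp0, Real.rpow_one])

/-- The topology generated by the seminorms `Lambda.seminorm t`, `t` real. -/
instance : TopologicalSpace (Lambda 𝕜 p α) :=
  SeminormFamily.moduleFilterBasis
    (fun t : ℝ => (seminorm t : Seminorm 𝕜 (Lambda 𝕜 p α))) |>.topology

theorem withSeminorms :
    WithSeminorms (fun t : ℝ => (seminorm t : Seminorm 𝕜 (Lambda 𝕜 p α))) := ⟨rfl⟩

end Lambda

/-! ### Power series spaces of order `0` and infinite type -/

theorem weighted_c0_bdd_aux {𝕜 : Type*} [RCLike 𝕜] {s : ℕ → ℝ} {x : ℕ → 𝕜}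
    (hx : Tendsto (fun n => ‖x n‖ * Real.exp (s n)) atTop (𝓝 0)) :
    BddAbove (Set.range fun n => ‖x n‖ * Real.exp (s n)) :=
  hx.bddAbove_range

/-- The vector space of all sequences `x` with `lim |x_n| e^{t α_n} = 0` for all real `t`. -/
def C0Submodule (𝕜 : Type*) [RCLike 𝕜] (α : ℕ → ℝ) : Submodule 𝕜 (ℕ → 𝕜) where
  carrier := {x | ∀ t : ℝ, Tendsto (fun n => ‖x n‖ * Real.exp (t * α n)) atTop (𝓝 0)}
  zero_mem' := fun t => by simp
  add_mem' := fun {x y} hx hy t => by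
    refine squeeze_zero (fun n => by positivity) (fun n => ?_)
      (by simpa using (hx t).add (hy t))
    rw [← add_mul]
    gcongr
    exact norm_add_le _ _
  smul_mem' := fun c x hx t => by
    simpa [mul_assoc] using (hx t).const_mul ‖c‖

/-- The power series space `C_{0,∞}(α)`. It is a type of its own, so that it does not carry the
topology of coordinatewise convergence. -/
def C0Space (𝕜 : Type*) [RCLike 𝕜] (α : ℕ → ℝ) : Type _ := ↥(C0Submodule 𝕜 α)

namespace C0Space

variable {𝕜 : Type*} [RCLike 𝕜] {α : ℕ → ℝ}

instance : AddCommGroup (C0Space 𝕜 α) := inferInstanceAs (AddCommGroup ↥(C0Submodule 𝕜 α))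

instance : Module 𝕜 (C0Space 𝕜 α) := inferInstanceAs (Module 𝕜 ↥(C0Submodule 𝕜 α))

instance : FunLike (C0Space 𝕜 α) ℕ 𝕜 where
  coe x := x.1
  coe_injective := Subtype.coe_injective

/-- The seminorm `sup_n |x_n| e^{t α_n}`. -/
def seminorm (t : ℝ) : Seminorm 𝕜 (C0Space 𝕜 α) :=
  Seminorm.of (fun x => ⨆ n, ‖x n‖ * Real.exp (t * α n))
    (fun x y => by
      refine ciSup_le fun n => ?_
      have h1 := le_ciSup (weighted_c0_bdd_aux (x.2 t)) n
      have h2 := le_ciSup (weighted_c0_bdd_aux (y.2 t)) n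
      refine le_trans ?_ (add_le_add h1 h2)
      rw [← add_mul]
      gcongr
      exact norm_add_le _ _)
    (fun c x => by
      have h : ∀ n, ‖(c • x : C0Space 𝕜 α) n‖ * Real.exp (t * α n) =
          ‖c‖ * (‖x n‖ * Real.exp (t * α n)) := fun n => by
        have h1 : (c • x : C0Space 𝕜 α) n = c * x n := rfl
        rw [h1, norm_mul, mul_assoc]
      simp only [h]
      rw [Real.mul_iSup_of_nonneg (norm_nonneg c)])

/-- The topology generated by the seminorms `C0Space.seminorm t`, `t` real. -/
instance : TopologicalSpace (C0Space 𝕜 α) :=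
  SeminormFamily.moduleFilterBasis
    (fun t : ℝ => (seminorm t : Seminorm 𝕜 (C0Space 𝕜 α))) |>.topology

theorem withSeminorms :
    WithSeminorms (fun t : ℝ => (seminorm t : Seminorm 𝕜 (C0Space 𝕜 α))) := ⟨rfl⟩

end C0Space

end

open scoped ENNReal

noncomputable section

/-! The diagonal `v` conjugates the unweighted backward shift to the shift with factors `v n / v (n
+ 1)`. Take `v = exp (-K u)`, where `u` is the sequence of partial sums of `α` restarted from zero
at each point of a set `S`. Since `u` grows by at most `α n` per step, the shift is continuous for
every `S`. At distance at least `j` to the right of `S`, `u n` dominates the window sum of length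
`j`. Either growth hypothesis then gives finite gauge to `v n * exp (s * α n)` there, with `j`
depending only on `s` (`HasDecay`).

For `S = {0}` this covers all but finitely many `n`. Thus `v` times any bounded sequence lies in
`X`, and repeating finite patterns gives dense periodic points (`dense_periodicPts_shift`). If `S`
is infinite, `v = 1` infinitely often, which no periodic point with non-zero initial coordinate
allows (`not_isChaotic_of_frequently`), so the shift is not chaotic.

Frequent hypercyclicity must therefore survive the restarts. Copies of finite patterns are planted
at times in sets `A k` of positive lower density. After shifting by a time `m`, the remaining blocks
sit at differences `n - m + i`, which must stay away from right neighbourhoods of `S`. This is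
arranged arithmetically: the moduli `P h` divide one another, the restart points satisfy `a (h + 1)
= a h + P h`, and `A k` consists of multiples of `P k` far from multiples of all later moduli
(`visitSet_sub_mem_gapSet`). Rapid growth keeps the density positive (`visitSet_hasPosDensity`). The
same vector construction serves `S = {0}`, giving the dense orbit of the chaotic shift. -/

/-! ### Gaps and lower density. -/

/-- The `q` whose distance to every smaller element of `S` is at least `j`. -/
def gapSet (S : Set ℕ) (j : ℕ) : Set ℕ := {q | ∀ s ∈ S, s ≤ q → s + j ≤ q}

theorem gapSet_antitone (S : Set ℕ) : Antitone (gapSet S) := fun i j hij q hq s hs hsq => by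
  have := hq s hs hsq
  omega

theorem gapSet_anti_left {S S' : Set ℕ} (h : S ⊆ S') (j : ℕ) : gapSet S' j ⊆ gapSet S j :=
  fun _ hq s hs => hq s (h hs)

/-- Positive lower density in quantitative form. -/
def HasPosDensity (A : Set ℕ) : Prop :=
  ∃ δ : ℝ, 0 < δ ∧ ∀ᶠ N : ℕ in atTop, δ * ((N : ℝ) + 1) ≤ ((A ∩ Set.Iic N).ncard : ℝ)

theorem HasPosDensity.mono {A B : Set ℕ} (hA : HasPosDensity A) (h : A ⊆ B) :
    HasPosDensity B := by
  obtain ⟨δ, hδ, hN⟩ := hA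
  refine ⟨δ, hδ, hN.mono fun N hN => hN.trans ?_⟩
  exact_mod_cast Set.ncard_le_ncard (Set.inter_subset_inter_left _ h)
    ((Set.finite_Iic N).inter_of_right B)

theorem HasPosDensity.lowerDensity_pos {A : Set ℕ} (hA : HasPosDensity A) :
    0 < lowerDensity A := by
  obtain ⟨δ, hδ, hN⟩ := hA
  refine hδ.trans_le (le_liminf_of_le ?_ ?_)
  · refine (isBoundedUnder_of ⟨1, fun N => ?_⟩ : IsBoundedUnder (· ≤ ·) atTop _).isCoboundedUnder_ge
    rw [div_le_one (by positivity)]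
    have h1 : (A ∩ Set.Iic N).ncard ≤ (Set.Iic N).ncard :=
      Set.ncard_le_ncard Set.inter_subset_right (Set.finite_Iic N)
    have h2 : (Set.Iic N).ncard = N + 1 := by
      rw [← Finset.coe_Iic, Set.ncard_coe_finset, Nat.card_Iic]
    rw [h2] at h1
    exact_mod_cast h1
  · filter_upwards [hN] with N hN
    rwa [le_div_iff₀ (by positivity)]

theorem nonempty_of_lowerDensity_pos {A : Set ℕ} (hA : 0 < lowerDensity A) : A.Nonempty := by
  by_contra h
  rw [Set.not_nonempty_iff_eq_empty] at h
  simp [lowerDensity, h] at hA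

/-! ### Restart points and visit times. -/

/-- Rapidly growing moduli `P` and points `a` adapted to the widths `w`. -/
structure IsScale (w a P : ℕ → ℕ) : Prop where
  w_mono : Monotone w
  lt_w : ∀ h, h < w h
  w_le_a : ∀ h, w h ≤ a h
  a_succ : ∀ h, a (h + 1) = a h + P h
  P_dvd : ∀ h, P h ∣ P (h + 1)
  two_mul_lt : ∀ h, 2 * (a h + w h) < P h
  growth : ∀ h, 2 ^ (h + 5) * (2 * (a (h + 1) + w (h + 1)) + 1) * P h ≤ P (h + 1)

theorem exists_isScale {w : ℕ → ℕ} (hw : Monotone w) (hlt : ∀ h, h < w h) :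
    ∃ a P, IsScale w a P := by
  let step : ℕ → ℕ × ℕ → ℕ × ℕ := fun h x =>
    -- The last factor makes the new modulus at least `w (h + 2)`, hence `w (h + 2) ≤ a (h + 2)`;
    -- the others give divisibility and growth.
    (x.1 + x.2, x.2 * (2 ^ (h + 5) * (2 * (x.1 + x.2 + w (h + 1)) + 1) * (1 + w (h + 2))))
  let X : ℕ → ℕ × ℕ := fun n =>
    Nat.rec (w 0, 2 * (w 0 + w 0) + 1 + w 1) (fun h x => step h x) n
  have hX : ∀ h, X (h + 1) = step h (X h) := fun h => rfl
  have ha : ∀ h, (X (h + 1)).1 = (X h).1 + (X h).2 := fun h => rfl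
  have hP : ∀ h, (X (h + 1)).2 = (X h).2 *
    (2 ^ (h + 5) * (2 * ((X (h + 1)).1 + w (h + 1)) + 1) * (1 + w (h + 2))) := fun h => rfl
  have hpos : ∀ h, 0 < (X h).2 := by
    intro h
    induction h with
    | zero => exact Nat.lt_of_lt_of_le (Nat.succ_pos _) (Nat.le_add_right _ _)
    | succ h ih => rw [hP]; positivity
  have hge : ∀ h, w (h + 1) ≤ (X h).2 := by
    intro h
    cases h with
    | zero => exact Nat.le_add_left _ _
    | succ h =>
      rw [hP]
      have h1 : 1 ≤ (X h).2 * (2 ^ (h + 5) * (2 * ((X (h + 1)).1 + w (h + 1)) + 1)) :=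
        Nat.mul_pos (hpos h) (by positivity)
      nlinarith [Nat.zero_le (w (h + 2))]
  have hgrowth : ∀ h, 2 ^ (h + 5) * (2 * ((X (h + 1)).1 + w (h + 1)) + 1) * (X h).2
      ≤ (X (h + 1)).2 := by
    intro h
    rw [hP h]
    have : 2 ^ (h + 5) * (2 * ((X (h + 1)).1 + w (h + 1)) + 1) ≤
      2 ^ (h + 5) * (2 * ((X (h + 1)).1 + w (h + 1)) + 1) * (1 + w (h + 2)) :=
      Nat.le_mul_of_pos_right _ (by omega)
    calc _ ≤ 2 ^ (h + 5) * (2 * ((X (h + 1)).1 + w (h + 1)) + 1) * (1 + w (h + 2)) * (X h).2 :=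
          Nat.mul_le_mul_right _ this
      _ = _ := by ring
  refine ⟨fun h => (X h).1, fun h => (X h).2, hw, hlt, ?_, ha, ?_, ?_, hgrowth⟩
  · intro h
    cases h with
    | zero => exact le_rfl
    | succ h => have := hge h; have := ha h; omega
  · exact fun h => ⟨_, hP h⟩
  · intro h
    cases h with
    | zero => exact Nat.lt_of_lt_of_le (Nat.lt_succ_self _) (Nat.le_add_right _ _)
    | succ h =>
      have h1 := hgrowth h
      have h2 : 1 * (2 * ((X (h + 1)).1 + w (h + 1)) + 1) * 1 ≤
          2 ^ (h + 5) * (2 * ((X (h + 1)).1 + w (h + 1)) + 1) * (X h).2 :=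
        Nat.mul_le_mul (Nat.mul_le_mul_right _ Nat.one_le_two_pow) (hpos h)
      omega

/-- Positive multiples of `P k` that stay away from the positive multiples of the later moduli. -/
def visitSet (w a P : ℕ → ℕ) (k : ℕ) : Set ℕ :=
  {n | 0 < n ∧ P k ∣ n ∧
    ∀ h, k < h → ∀ c, 0 < c → n + (a h + w h) < c * P h ∨ c * P h + (a h + w h) < n}

/-- The set of points at which the weights will be restarted. -/
def restartSet (a : ℕ → ℕ) : Set ℕ := insert 0 (Set.range a)

theorem visitSet_disjoint {w a P : ℕ → ℕ} {k l n : ℕ} (hk : n ∈ visitSet w a P k) (hl : n ∈ visitSet w a P l) :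
    k = l := by
  have key : ∀ {k l}, n ∈ visitSet w a P k → n ∈ visitSet w a P l → ¬ k < l := by
    intro k l hk hl hkl
    obtain ⟨h0, ⟨c, rfl⟩, -⟩ := hl
    have := hk.2.2 l hkl c (Nat.pos_of_mul_pos_left h0)
    rw [mul_comm] at this
    omega
  exact le_antisymm (not_lt.1 (key hl hk)) (not_lt.1 (key hk hl))

namespace IsScale

variable {w a P : ℕ → ℕ} (H : IsScale w a P)
include H

theorem P_pos (h : ℕ) : 0 < P h := by have := H.two_mul_lt h; omega

theorem P_dvd_of_le {h k : ℕ} (hk : h ≤ k) : P h ∣ P k := by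
  induction k, hk using Nat.le_induction with
  | base => exact dvd_rfl
  | succ k _ ih => exact ih.trans (H.P_dvd k)

theorem a_strictMono : StrictMono a :=
  strictMono_nat_of_lt_succ fun h => by have := H.a_succ h; have := H.P_pos h; omega

/-- Every increment from index `h` on is a multiple of `P h`, so all later restart points lie in the
residue class of `a h` modulo `P h`. -/
theorem a_eq_add_mul {h r : ℕ} (hr : h ≤ r) : ∃ b, a r = a h + b * P h := by
  induction r, hr using Nat.le_induction with
  | base => exact ⟨0, by simp⟩
  | succ r hr ih =>
    obtain ⟨b, hb⟩ := ih
    obtain ⟨c, hc⟩ := H.P_dvd_of_le hr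
    exact ⟨b + c, by rw [H.a_succ, hb, hc]; ring⟩

/-- Restart points of index at most `k` are at most `a k`, far below `P k`. Later ones are `a k + b
* P k`, and if not beyond `c * P k + i` they have `b < c`, leaving a gap of at least `P k - a k`,
which exceeds `w k`. -/
theorem mul_add_mem_gapSet {k c i : ℕ} (hc : 0 < c) (hi : i ≤ k) :
    c * P k + i ∈ gapSet (restartSet a) (w k) := by
  have h1 := H.two_mul_lt k
  have h2 := H.w_le_a k
  have h3 := H.lt_w k
  have h4 : P k ≤ c * P k := Nat.le_mul_of_pos_left _ hc
  rintro s (rfl | ⟨r, rfl⟩) hs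
  · omega
  · rcases le_total r k with hr | hr
    · have := H.a_strictMono.monotone hr
      omega
    · obtain ⟨b, hb⟩ := H.a_eq_add_mul hr
      have hbc : b < c := by
        by_contra! hcb
        have := Nat.mul_le_mul_right (P k) hcb
        omega
      have : (b + 1) * P k ≤ c * P k := Nat.mul_le_mul_right _ hbc
      rw [add_mul, one_mul] at this
      omega

theorem visitSet_add_mem_gapSet {l n i : ℕ} (hn : n ∈ visitSet w a P l) (hi : i ≤ l) :
    n + i ∈ gapSet (restartSet a) (w l) := by
  obtain ⟨h0, ⟨c, rfl⟩, -⟩ := hn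
  rw [mul_comm]
  exact H.mul_add_mem_gapSet (Nat.pos_of_mul_pos_left h0) hi

/-- Needed for the planted vector itself to lie in `X`. A restart point `a (r + 1)` with `r ≥ h > l`
is `P r + a r`, and a visit time keeps distance more than `a r + w r` from `P r`. -/
theorem visitSet_eventually_mem_gapSet {h l n i : ℕ} (hn : n ∈ visitSet w a P l) (hi : i ≤ l)
    (hq : a h + w h ≤ n + i) : n + i ∈ gapSet (restartSet a) (w h) := by
  rcases le_or_gt h l with hl | hl
  · exact gapSet_antitone _ (H.w_mono hl) (H.visitSet_add_mem_gapSet hn hi)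
  · rintro s (rfl | ⟨r, rfl⟩) hs
    · omega
    · rcases le_or_gt r h with hr | hr
      · have := H.a_strictMono.monotone hr
        omega
      · obtain ⟨r, rfl⟩ : ∃ r', r = r' + 1 := ⟨r - 1, by omega⟩
        have h1 := hn.2.2 r (by omega) 1 one_pos
        have h2 := H.w_mono (show h ≤ r by omega)
        have h3 := H.a_succ r
        have h4 := H.lt_w r
        omega

/-- The larger of the two indices decides. One time is a multiple of that modulus; if the indices
differ, the other time is far from all its positive multiples, so the difference avoids the residue
class of the restart points and a stretch to its right. -/
theorem visitSet_sub_mem_gapSet {k l m n i : ℕ} (hm : m ∈ visitSet w a P k)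
    (hn : n ∈ visitSet w a P l) (hmn : m < n) (hi : i ≤ l) :
    n - m + i ∈ gapSet (restartSet a) (w (max k l)) := by
  rcases lt_trichotomy k l with hkl | rfl | hkl
  · rw [max_eq_right hkl.le]
    obtain ⟨h0, ⟨c, rfl⟩, -⟩ := hn
    have hc := Nat.pos_of_mul_pos_left h0
    rw [mul_comm] at hmn h0 ⊢
    have h1 := H.two_mul_lt l
    have h2 := H.w_le_a l
    have h3 := H.lt_w l
    have h4 := hm.2.2 l hkl c hc
    rintro s (rfl | ⟨r, rfl⟩) hs
    · omega
    · rcases le_total r l with hr | hr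
      · have := H.a_strictMono.monotone hr
        omega
      · obtain ⟨b, hb⟩ := H.a_eq_add_mul hr
        have hm0 := hm.1
        have hbc : b < c := by
          by_contra! hcb
          have := Nat.mul_le_mul_right (P l) hcb
          omega
        have h5 := hm.2.2 l hkl (c - b) (by omega)
        rw [Nat.sub_mul] at h5
        have : b * P l ≤ c * P l := Nat.mul_le_mul_right _ hbc.le
        omega
  · rw [max_self]
    obtain ⟨-, ⟨c, rfl⟩, -⟩ := hm
    obtain ⟨-, ⟨d, rfl⟩, -⟩ := hn
    have hcd : c < d := lt_of_mul_lt_mul_left hmn (Nat.zero_le _)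
    rw [← Nat.mul_sub, mul_comm]
    exact H.mul_add_mem_gapSet (by omega) hi
  · rw [max_eq_left hkl.le]
    obtain ⟨h0, ⟨c, rfl⟩, -⟩ := hm
    have hc := Nat.pos_of_mul_pos_left h0
    rw [mul_comm] at hmn h0 ⊢
    have h1 := H.two_mul_lt k
    have h2 := H.w_le_a k
    have h3 := H.lt_w k
    have h4 := hn.2.2 k hkl c hc
    rintro s (rfl | ⟨r, rfl⟩) hs
    · omega
    · rcases le_total r k with hr | hr
      · have := H.a_strictMono.monotone hr
        omega
      · obtain ⟨b, hb⟩ := H.a_eq_add_mul hr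
        have h5 := hn.2.2 k hkl (c + b) (by omega)
        rw [add_mul] at h5
        omega

theorem growth_of_lt {l h : ℕ} (hl : l < h) :
    2 ^ (h + 4) * (2 * (a h + w h) + 1) * P l ≤ P h := by
  obtain ⟨h, rfl⟩ : ∃ h', h = h' + 1 := ⟨h - 1, by omega⟩
  exact (Nat.mul_le_mul_left _ (Nat.le_of_dvd (H.P_pos h) (H.P_dvd_of_le (by omega)))).trans
    (H.growth h)

/-- Multiples of `P l` have density `1 / P l`. By the growth condition, the excluded neighbourhoods
for modulus `P h` cost at most a fraction `2 ^ (-h) / (8 * P l)` of the integers up to `N`, which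
sums to at most a quarter of that density. -/
theorem visitSet_hasPosDensity (l : ℕ) : HasPosDensity (visitSet w a P l) := by
  have hPl : (0 : ℝ) < P l := by exact_mod_cast H.P_pos l
  refine ⟨1 / (4 * P l), by positivity, ?_⟩
  filter_upwards [eventually_ge_atTop (4 * P l)] with N hN
  let F : Finset ℕ := (Finset.Icc 1 (N / P l)).image (· * P l)
  -- The bound `2 * N` accounts for multiples beyond `N` whose neighbourhood reaches below `N`; the
  -- radius is less than `P h / 2`.
  let B : ℕ → Finset ℕ := fun h => (Finset.Icc 1 (2 * N / P h)).biUnion fun c =>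
    Finset.Icc (c * P h - (a h + w h)) (c * P h + (a h + w h))
  have hF : F.card = N / P l := by
    rw [Finset.card_image_of_injective _ (fun x y hxy => Nat.eq_of_mul_eq_mul_right (H.P_pos l) hxy)]
    simp
  have hsub : ((F \ (Finset.Ioc l N).biUnion B : Finset ℕ) : Set ℕ) ⊆
      visitSet w a P l ∩ Set.Iic N := by
    intro n hn
    simp only [Finset.coe_sdiff, Set.mem_sdiff, Finset.mem_coe, F, Finset.mem_image,
      Finset.mem_Icc, Finset.mem_biUnion, not_exists, not_and, B, Finset.mem_Ioc] at hn
    obtain ⟨⟨b, ⟨hb1, hb2⟩, rfl⟩, hbad⟩ := hn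
    have hbN : b * P l ≤ N := (Nat.le_div_iff_mul_le (H.P_pos l)).1 hb2
    refine ⟨⟨Nat.mul_pos hb1 (H.P_pos l), ⟨b, mul_comm _ _⟩, fun h hh c hc => ?_⟩, hbN⟩
    by_contra! hcon
    have h1 := H.two_mul_lt h
    have h2 : P h ≤ c * P h := Nat.le_mul_of_pos_left _ hc
    have h3 : c * P h ≤ 2 * N := by omega
    -- An excluded `n ≤ N` satisfies `n > a h + w h > h`, so only finitely many moduli matter.
    have h4 : h ≤ N := by have := H.lt_w h; omega
    exact hbad h ⟨hh, h4⟩ c ⟨hc, (Nat.le_div_iff_mul_le (H.P_pos h)).2 h3⟩ (by omega) (by omega)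
  have hB : ∀ h ∈ Finset.Ioc l N, ((B h).card : ℝ) ≤ N / (8 * P l) * (1 / 2) ^ h := by
    intro h hh
    have hPh : (0 : ℝ) < P h := by exact_mod_cast H.P_pos h
    have h1 : (B h).card ≤ (2 * N / P h) * (2 * (a h + w h) + 1) := by
      refine (Finset.card_biUnion_le_card_mul _ _ (2 * (a h + w h) + 1) fun c _ => ?_).trans
        (by simp)
      rw [Nat.card_Icc]
      omega
    have h2 : ((2 * N / P h : ℕ) : ℝ) ≤ 2 * N / P h := by
      simpa using (Nat.cast_div_le (α := ℝ) (m := 2 * N) (n := P h))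
    have h3 : (2 : ℝ) ^ (h + 4) * (2 * (a h + w h) + 1) * P l ≤ P h := by
      exact_mod_cast H.growth_of_lt (Finset.mem_Ioc.1 hh).1
    have h4 : ((B h).card : ℝ) ≤ (2 * N / P h : ℕ) * (2 * (a h + w h) + 1) := by exact_mod_cast h1
    calc ((B h).card : ℝ) ≤ (2 * N / P h) * (2 * (a h + w h) + 1) := h4.trans (by gcongr)
      _ ≤ N / (8 * P l) * (1 / 2) ^ h := by
        rw [div_mul_eq_mul_div, div_mul_eq_mul_div, one_div, inv_pow, div_le_div_iff₀ hPh
          (by positivity), ← div_eq_mul_inv, div_mul_eq_mul_div, le_div_iff₀ (by positivity)]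
        calc _ = (N : ℝ) * (2 ^ (h + 4) * (2 * (a h + w h) + 1) * P l) := by ring
          _ ≤ _ := by gcongr
  have hBsum : (((Finset.Ioc l N).biUnion B).card : ℝ) ≤ N / (4 * P l) := by
    calc (((Finset.Ioc l N).biUnion B).card : ℝ) ≤ ∑ h ∈ Finset.Ioc l N, ((B h).card : ℝ) := by
          exact_mod_cast Finset.card_biUnion_le
      _ ≤ ∑ h ∈ Finset.Ioc l N, N / (8 * P l) * (1 / 2 : ℝ) ^ h := Finset.sum_le_sum hB
      _ = N / (8 * P l) * ∑ h ∈ Finset.Ioc l N, (1 / 2 : ℝ) ^ h := by rw [Finset.mul_sum]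
      _ ≤ N / (8 * P l) * 2 := by
        gcongr
        exact (summable_geometric_two.sum_le_tsum _ fun _ _ => by positivity).trans
          tsum_geometric_two.le
      _ = _ := by field_simp; ring
  have hcard : (F.card : ℝ) - ((Finset.Ioc l N).biUnion B).card ≤
      ((visitSet w a P l ∩ Set.Iic N).ncard : ℝ) := by
    have h1 := Set.ncard_le_ncard hsub ((Set.finite_Iic N).inter_of_right _)
    rw [Set.ncard_coe_finset] at h1
    have h2 := Finset.le_card_sdiff ((Finset.Ioc l N).biUnion B) F
    have h3 : F.card ≤ (visitSet w a P l ∩ Set.Iic N).ncard +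
      ((Finset.Ioc l N).biUnion B).card := by omega
    rw [sub_le_iff_le_add]
    exact_mod_cast h3
  have hdiv : (N : ℝ) / P l - 1 ≤ F.card := by
    rw [hF]
    have := Nat.lt_div_mul_add (a := N) (H.P_pos l)
    have h2 : (N : ℝ) < (N / P l : ℕ) * P l + P l := by exact_mod_cast this
    rw [sub_le_iff_le_add, div_le_iff₀ hPl]
    nlinarith
  have hN' : (4 : ℝ) * P l ≤ N := by exact_mod_cast hN
  have hx : (4 : ℝ) ≤ N / P l := by rwa [le_div_iff₀ hPl]
  have e1 : (N : ℝ) / (4 * P l) = N / P l / 4 := by rw [mul_comm, div_div]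
  have e2 : 1 / (4 * P l) * ((N : ℝ) + 1) = N / P l / 4 + 1 / (P l) / 4 := by field_simp
  have e3 : (1 : ℝ) / P l ≤ 1 := by
    rw [div_le_one hPl]
    exact_mod_cast H.P_pos l
  rw [e2]
  rw [e1] at hBsum
  linarith

end IsScale

/-! ### Gauges and gauge spaces. -/

/-- Solid extended norms on real sequences, such as the `ℓ^p`-norms and the supremum norm. -/
structure IsSolidGauge (L : (ℕ → ℝ) → ℝ≥0∞) : Prop where
  mono : ∀ {a b : ℕ → ℝ}, (∀ n, 0 ≤ a n) → (∀ n, a n ≤ b n) → L a ≤ L b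
  const_mul_le : ∀ {c : ℝ} {a : ℕ → ℝ}, 0 ≤ c → (∀ n, 0 ≤ a n) →
    L (fun n => c * a n) ≤ ENNReal.ofReal c * L a
  comp_succ_le : ∀ {a : ℕ → ℝ}, (∀ n, 0 ≤ a n) → L (fun n => a (n + 1)) ≤ L a
  ofReal_apply_le : ∀ {a : ℕ → ℝ} (n : ℕ), (∀ n, 0 ≤ a n) → ENNReal.ofReal (a n) ≤ L a
  ne_top_of_eventually_le : ∀ {a b : ℕ → ℝ}, (∀ n, 0 ≤ a n) → (∀ n, 0 ≤ b n) →
    (∀ᶠ n in atTop, a n ≤ b n) → L b ≠ ⊤ → L a ≠ ⊤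
  zero_ne_top : L (fun _ => 0) ≠ ⊤

/-- The gauge of the sequence `f` with the weight `e^{s α_n}`. -/
def weightedGauge {𝕜 : Type*} [RCLike 𝕜] (L : (ℕ → ℝ) → ℝ≥0∞) (α : ℕ → ℝ) (s : ℝ) (f : ℕ → 𝕜) :
    ℝ≥0∞ :=
  L fun n => ‖f n‖ * Real.exp (s * α n)

/-- `X` is the space of all sequences whose weighted gauges are finite, with the topology that
these generate. -/
structure IsGaugeSpace (L : (ℕ → ℝ) → ℝ≥0∞) (α : ℕ → ℝ) (𝕜 X : Type*) [RCLike 𝕜]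
    [AddCommGroup X] [Module 𝕜 X] [TopologicalSpace X] [FunLike X ℕ 𝕜] : Prop where
  add_apply : ∀ (x y : X) n, (x + y) n = x n + y n
  sub_apply : ∀ (x y : X) n, (x - y) n = x n - y n
  smul_apply : ∀ (c : 𝕜) (x : X) n, (c • x) n = c * x n
  gauge_ne_top : ∀ (x : X) s, weightedGauge L α s (x : ℕ → 𝕜) ≠ ⊤
  exists_coe_eq : ∀ f : ℕ → 𝕜, (∀ s, weightedGauge L α s f ≠ ⊤) → ∃ x : X, ∀ n, x n = f n
  mem_nhds_iff : ∀ {x : X} {U : Set X}, U ∈ 𝓝 x ↔ ∃ s : ℝ, ∃ ε : ℝ≥0∞, 0 < ε ∧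
    ∀ y : X, weightedGauge L α s ((y - x : X) : ℕ → 𝕜) < ε → y ∈ U

theorem eventually_ofReal_mul_lt {u : ℕ → ℝ} (hu : Tendsto u atTop (𝓝 0)) {M ε : ℝ≥0∞}
    (hM : M ≠ ⊤) (hε : 0 < ε) : ∀ᶠ n in atTop, ENNReal.ofReal (u n) * M < ε := by
  have h1 : Tendsto (fun n => ENNReal.ofReal (u n) * M) atTop (𝓝 (ENNReal.ofReal 0 * M)) :=
    ENNReal.Tendsto.mul_const (ENNReal.tendsto_ofReal hu) (Or.inr hM)
  rw [ENNReal.ofReal_zero, zero_mul] at h1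
  exact h1.eventually_lt_const hε

theorem exists_pos_ofReal_mul_lt {M ε : ℝ≥0∞} (hM : M ≠ ⊤) (hε : 0 < ε) :
    ∃ δ : ℝ, 0 < δ ∧ ENNReal.ofReal δ * M < ε := by
  obtain ⟨n, hn⟩ :=
    (eventually_ofReal_mul_lt (tendsto_one_div_add_atTop_nhds_zero_nat (𝕜 := ℝ)) hM hε).exists
  exact ⟨_, by positivity, hn⟩

theorem tendsto_exp_neg_comp {α : ℕ → ℝ} (hlim : Tendsto α atTop atTop) :
    Tendsto (fun n => Real.exp (-α n)) atTop (𝓝 0) :=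
  Real.tendsto_exp_atBot.comp (tendsto_neg_atTop_atBot.comp hlim)

/-! ### A countable family of finite patterns. -/

/-- The finitely supported sequences with entries from a fixed dense sequence of scalars. -/
def simpleSeq (𝕜 : Type*) [RCLike 𝕜] (c : ℕ →₀ ℕ) (n : ℕ) : 𝕜 :=
  -- The code `0` is reserved for a zero entry, so a finitely supported code gives a finitely
  -- supported sequence.
  if c n = 0 then 0 else TopologicalSpace.denseSeq 𝕜 (c n - 1)

theorem eventually_simpleSeq_eq_zero (𝕜 : Type*) [RCLike 𝕜] (c : ℕ →₀ ℕ) :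
    ∃ N, ∀ n, N ≤ n → simpleSeq 𝕜 c n = 0 := by
  refine ⟨c.support.sup id + 1, fun n hn => if_pos ?_⟩
  by_contra h
  have := Finset.le_sup (f := id) (Finsupp.mem_support_iff.2 h)
  simp only [id] at this
  omega

theorem exists_bound_simpleSeq (𝕜 : Type*) [RCLike 𝕜] (c : ℕ →₀ ℕ) :
    ∃ C : ℝ, ∀ n, ‖simpleSeq 𝕜 c n‖ ≤ C := by
  obtain ⟨N, hN⟩ := eventually_simpleSeq_eq_zero 𝕜 c
  refine ⟨∑ n ∈ Finset.range N, ‖simpleSeq 𝕜 c n‖, fun n => ?_⟩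
  rcases lt_or_ge n N with h | h
  · exact Finset.single_le_sum (f := fun n => ‖simpleSeq 𝕜 c n‖) (fun _ _ => norm_nonneg _)
      (Finset.mem_range.2 h)
  · rw [hN n h, norm_zero]
    exact Finset.sum_nonneg fun _ _ => norm_nonneg _

/-- An enumeration of the simple sequences in which each of them recurs, and whose `k`-th term
has support in `[0, k]` and entries bounded by `k`. -/
theorem exists_recurrent_enumeration (𝕜 : Type*) [RCLike 𝕜] :
    ∃ z : ℕ → ℕ → 𝕜, (∀ k i, k < i → z k i = 0) ∧ (∀ k i, ‖z k i‖ ≤ k) ∧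
      ∀ c, ∃ᶠ k in atTop, z k = simpleSeq 𝕜 c := by
  classical
  obtain ⟨e, he⟩ := exists_surjective_nat (ℕ →₀ ℕ)
  -- Unpairing makes every code recur; indices still too small for the support or the bound get the
  -- zero sequence.
  let good : ℕ → Prop := fun k => (∀ i, k < i → simpleSeq 𝕜 (e (Nat.unpair k).1) i = 0) ∧
    ∀ i, ‖simpleSeq 𝕜 (e (Nat.unpair k).1) i‖ ≤ k
  refine ⟨fun k => if good k then simpleSeq 𝕜 (e (Nat.unpair k).1) else 0, fun k i hki => ?_,
    fun k i => ?_, fun c => ?_⟩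
  · dsimp only
    split_ifs with h
    · exact h.1 i hki
    · rfl
  · dsimp only
    split_ifs with h
    · exact h.2 i
    · simp
  · obtain ⟨m, rfl⟩ := he c
    obtain ⟨N, hN⟩ := eventually_simpleSeq_eq_zero 𝕜 (e m)
    obtain ⟨C, hC⟩ := exists_bound_simpleSeq 𝕜 (e m)
    rw [frequently_atTop]
    intro b
    obtain ⟨C', hC'⟩ := exists_nat_ge C
    have h1 : b + N + C' ≤ Nat.pair m (b + N + C') := Nat.right_le_pair _ _
    refine ⟨Nat.pair m (b + N + C'), by omega, ?_⟩
    dsimp only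
    rw [if_pos]
    · simp
    · simp only [good, Nat.unpair_pair]
      refine ⟨fun i hi => hN i (by omega), fun i => (hC i).trans (hC'.trans ?_)⟩
      exact_mod_cast (by omega : C' ≤ Nat.pair m (b + N + C'))

/-- The weights of the shift that is conjugate, via the diagonal `v`, to the unweighted shift. -/
def weightOf (𝕜 : Type*) [RCLike 𝕜] (v : ℕ → ℝ) (n : ℕ) : 𝕜 :=
  if n = 0 then 1 else ((v (n - 1) / v n : ℝ) : 𝕜)

theorem IsFrequentlyHypercyclic.isHypercyclic {X : Type*} [TopologicalSpace X] {f : X → X} (h : IsFrequentlyHypercyclic f) :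
    IsHypercyclic f := by
  obtain ⟨x, hx⟩ := h
  refine ⟨x, dense_iff_inter_open.2 fun U hU hne => ?_⟩
  obtain ⟨n, hn⟩ := nonempty_of_lowerDensity_pos (hx U hU hne)
  exact ⟨_, hn, n, rfl⟩

/-! ### Dynamics of weighted shifts on gauge spaces. -/

section GaugeSpace

variable {𝕜 X : Type*} [RCLike 𝕜] [AddCommGroup X] [Module 𝕜 X] [TopologicalSpace X]
  [FunLike X ℕ 𝕜] {L : (ℕ → ℝ) → ℝ≥0∞} {α v : ℕ → ℝ}

theorem IsSolidGauge.ne_top_of_eventually_eq_zero (hL : IsSolidGauge L) {a : ℕ → ℝ}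
    (ha : ∀ n, 0 ≤ a n) {N : ℕ} (h : ∀ n, N ≤ n → a n = 0) : L a ≠ ⊤ :=
  hL.ne_top_of_eventually_le ha (fun _ => le_rfl)
    (by filter_upwards [eventually_ge_atTop N] with n hn using (h n hn).le) hL.zero_ne_top

/-- The continuity estimate. Passing from `α n` to `α (n + 1)` needs a non-negative exponent, hence
the maximum with `0`. -/
theorem weightedGauge_shift_le (hL : IsSolidGauge L) (hpos : ∀ n, 0 < α n) (hmono : Monotone α)
    {K : ℝ} {c : ℕ → ℝ} (hc0 : ∀ n, 0 ≤ c n) (hc : ∀ n, c n ≤ Real.exp (K * α n)) (s : ℝ)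
    (f : ℕ → 𝕜) :
    weightedGauge L α s (fun n => (c n : 𝕜) * f (n + 1)) ≤ weightedGauge L α (max (s + K) 0) f := by
  refine le_trans (hL.mono (b := fun n => ‖f (n + 1)‖ * Real.exp (max (s + K) 0 * α (n + 1)))
    (fun n => by positivity) fun n => ?_)
    (hL.comp_succ_le (a := fun n => ‖f n‖ * Real.exp (max (s + K) 0 * α n))
      fun n => by positivity)
  rw [norm_mul, RCLike.norm_ofReal, abs_of_nonneg (hc0 n), mul_comm (c n), mul_assoc]
  gcongr
  calc c n * Real.exp (s * α n) ≤ Real.exp (K * α n) * Real.exp (s * α n) := by gcongr; exact hc n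
    _ = Real.exp ((s + K) * α n) := by rw [← Real.exp_add]; ring_nf
    _ ≤ _ := by
      refine Real.exp_le_exp.2 (mul_le_mul (le_max_left _ _) (hmono (Nat.le_succ n))
        (hpos n).le (le_max_right _ _))

theorem exists_weightedShift (hL : IsSolidGauge L) (hX : IsGaugeSpace L α 𝕜 X)
    (hpos : ∀ n, 0 < α n) (hmono : Monotone α) (hv : ∀ n, 0 < v n) {K : ℝ}
    (hK : ∀ n, v n ≤ Real.exp (K * α n) * v (n + 1)) :
    ∃ T : X →L[𝕜] X, IsWeightedShift T (weightOf 𝕜 v) ∧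
      ∀ (x : X) n, T x n = ((v n / v (n + 1) : ℝ) : 𝕜) * x (n + 1) := by
  have hb := weightedGauge_shift_le (𝕜 := 𝕜) hL hpos hmono (K := K)
    (c := fun n => v n / v (n + 1)) (fun n => (div_pos (hv _) (hv _)).le)
    (fun n => (div_le_iff₀ (hv _)).2 (hK n))
  choose g hg using fun x : X => hX.exists_coe_eq
    (fun n => ((v n / v (n + 1) : ℝ) : 𝕜) * x (n + 1))
    fun s => ne_top_of_le_ne_top (hX.gauge_ne_top x _) (hb s x)
  let T : X →ₗ[𝕜] X :=
    { toFun := g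
      map_add' := fun x y => DFunLike.ext _ _ fun n => by
        rw [hX.add_apply, hg, hg, hg, hX.add_apply, mul_add]
      map_smul' := fun c x => DFunLike.ext _ _ fun n => by
        rw [RingHom.id_apply, hX.smul_apply, hg, hg, hX.smul_apply]; ring }
  have hT : ∀ (x : X) n, T x n = ((v n / v (n + 1) : ℝ) : 𝕜) * x (n + 1) := hg
  have hcont : Continuous T := by
    rw [continuous_iff_continuousAt]
    intro x U hU
    obtain ⟨s, ε, hε, hsub⟩ := hX.mem_nhds_iff.1 hU
    refine hX.mem_nhds_iff.2 ⟨max (s + K) 0, ε, hε, fun y hy => hsub _ ?_⟩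
    rw [← map_sub]
    have : ((T (y - x) : X) : ℕ → 𝕜) =
        fun n => ((v n / v (n + 1) : ℝ) : 𝕜) * (y - x) (n + 1) := funext fun n => hT _ n
    rw [this]
    exact (hb s _).trans_lt hy
  refine ⟨⟨T, hcont⟩, ⟨fun n => ?_, fun x n => ?_⟩, hT⟩
  · unfold weightOf
    split_ifs
    · exact one_ne_zero
    · exact RCLike.ofReal_ne_zero.2 (div_pos (hv _) (hv _)).ne'
  · exact hT x n

theorem iterate_shift_apply (hv : ∀ n, 0 < v n) {T : X →L[𝕜] X}
    (hT : ∀ (x : X) n, T x n = ((v n / v (n + 1) : ℝ) : 𝕜) * x (n + 1)) (m : ℕ) (x : X) (n : ℕ) :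
    T^[m] x n = ((v n / v (n + m) : ℝ) : 𝕜) * x (n + m) := by
  induction m generalizing n with
  | zero => simp [(hv n).ne']
  | succ m ih =>
    rw [Function.iterate_succ_apply', hT, ih, ← mul_assoc, ← RCLike.ofReal_mul,
      div_mul_div_cancel₀ (hv _).ne', add_right_comm n 1 m, add_assoc]

/-- Truncation at `N` costs at most `exp (-α N)` times the gauge of exponent `s + 1`; the finitely
many remaining coordinates are then approximated by scalars from the dense sequence. -/
theorem exists_simple_mem (hL : IsSolidGauge L) (hX : IsGaugeSpace L α 𝕜 X) (hmono : Monotone α)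
    (hlim : Tendsto α atTop atTop) (hv : ∀ n, 0 < v n) {U : Set X} (hU : IsOpen U)
    (hne : U.Nonempty) :
    ∃ x ∈ U, ∃ c, ∀ n, x n = (v n : 𝕜) * simpleSeq 𝕜 c n := by
  classical
  obtain ⟨x, hx⟩ := hne
  obtain ⟨s, ε, hε, hsub⟩ := hX.mem_nhds_iff.1 (hU.mem_nhds hx)
  obtain ⟨N, hN⟩ := (eventually_ofReal_mul_lt (tendsto_exp_neg_comp hlim)
    (hX.gauge_ne_top x (s + 1)) hε).exists
  obtain ⟨x', hx'⟩ := hX.exists_coe_eq (fun n => if n < N then x n else 0) fun s =>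
    ne_top_of_le_ne_top (hX.gauge_ne_top x s) (hL.mono (fun n => by positivity) fun n => by
      gcongr
      dsimp only
      split_ifs
      · exact le_rfl
      · simp)
  have hx'U : x' ∈ U := by
    refine hsub _ (lt_of_le_of_lt ?_ hN)
    refine (hL.mono (fun n => by positivity) fun n => ?_).trans
      (hL.const_mul_le (Real.exp_pos _).le fun n => by positivity)
    rw [hX.sub_apply, hx']
    split_ifs with h
    · simp only [sub_self, norm_zero, zero_mul]
      positivity
    · have : α N ≤ α n := hmono (not_lt.1 h)
      rw [zero_sub, norm_neg, mul_left_comm, ← Real.exp_add]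
      gcongr
      linarith
  obtain ⟨t, η, hη, hsub'⟩ := hX.mem_nhds_iff.1 (hU.mem_nhds hx'U)
  have hfin : L (fun n => if n < N then Real.exp (t * α n) else 0) ≠ ⊤ :=
    hL.ne_top_of_eventually_eq_zero (fun n => by split_ifs <;> positivity)
      (N := N) fun n hn => if_neg (not_lt.2 hn)
  obtain ⟨δ, hδ, hδη⟩ := exists_pos_ofReal_mul_lt hfin hη
  have happrox : ∀ n, ∃ i, ‖(v n : 𝕜) * TopologicalSpace.denseSeq 𝕜 i - x n‖ ≤ δ := by
    intro n
    have hvn : (v n : 𝕜) ≠ 0 := RCLike.ofReal_ne_zero.2 (hv n).ne'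
    obtain ⟨-, hi, ⟨i, rfl⟩⟩ := Metric.dense_iff.1 (TopologicalSpace.denseRange_denseSeq 𝕜)
      (x n / v n) (δ / v n) (div_pos hδ (hv n))
    refine ⟨i, ?_⟩
    rw [Metric.mem_ball, dist_eq_norm, lt_div_iff₀ (hv n)] at hi
    have h1 : (v n : 𝕜) * TopologicalSpace.denseSeq 𝕜 i - x n =
        (TopologicalSpace.denseSeq 𝕜 i - x n / v n) * v n := by
      rw [sub_mul, div_mul_cancel₀ _ hvn, mul_comm]
    rw [h1, norm_mul, RCLike.norm_ofReal, abs_of_pos (hv n)]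
    exact hi.le
  choose i hi using happrox
  let c : ℕ →₀ ℕ := Finsupp.onFinset (Finset.range N) (fun n => if n < N then i n + 1 else 0)
    (fun n hn => by
      rw [Finset.mem_range]
      by_contra h
      exact hn (if_neg h))
  have hc : ∀ n, simpleSeq 𝕜 c n =
      if n < N then TopologicalSpace.denseSeq 𝕜 (i n) else 0 := by
    intro n
    by_cases h : n < N <;> simp [simpleSeq, c, h]
  obtain ⟨y, hy⟩ := hX.exists_coe_eq (fun n => (v n : 𝕜) * simpleSeq 𝕜 c n) fun s =>
    hL.ne_top_of_eventually_eq_zero (fun n => by positivity) (N := N) fun n hn => by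
      simp [hc, not_lt.2 hn]
  refine ⟨y, hsub' _ (lt_of_le_of_lt ?_ hδη), c, hy⟩
  refine (hL.mono (fun n => by positivity) fun n => ?_).trans
    (hL.const_mul_le hδ.le fun n => by split_ifs <;> positivity)
  rw [hX.sub_apply, hy, hx', hc]
  split_ifs with h
  · gcongr
    exact hi n
  · simp

/-- The sequence that has, for each `n ∈ A k`, a copy of `z k` starting at position `n`. -/
theorem exists_planted_sequence {A : ℕ → Set ℕ} {z : ℕ → ℕ → 𝕜}
    (hsep : ∀ k l m n, m ∈ A k → n ∈ A l → m < n → max k l < n - m)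
    (hdisj : ∀ k l n, n ∈ A k → n ∈ A l → k = l) :
    ∃ y : ℕ → 𝕜, (∀ k m i, m ∈ A k → i ≤ k → y (m + i) = z k i) ∧
      ∀ q, y q ≠ 0 → ∃ l n i, n ∈ A l ∧ i ≤ l ∧ q = n + i ∧ y q = z l i := by
  classical
  -- For `x = (l, n)` this says that `q` lies in the block `[n, n + l]`; by separation and
  -- disjointness the block is unique.
  let p : ℕ → ℕ × ℕ → Prop := fun q x => x.2 ∈ A x.1 ∧ x.2 ≤ q ∧ q ≤ x.2 + x.1
  refine ⟨fun q => if h : ∃ x, p q x then z h.choose.1 (q - h.choose.2) else 0, ?_, ?_⟩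
  · intro k m i hm hi
    have h : ∃ x, p (m + i) x := ⟨(k, m), hm, by simp, by simpa using hi⟩
    dsimp only
    rw [dif_pos h]
    obtain ⟨h1, h2, h3⟩ := h.choose_spec
    generalize h.choose = x at h1 h2 h3
    obtain ⟨l, n⟩ := x
    dsimp only at h1 h2 h3 ⊢
    rcases lt_trichotomy m n with hmn | rfl | hmn
    · have := hsep k l m n hm h1 hmn
      omega
    · rw [hdisj k l m hm h1, Nat.add_sub_cancel_left]
    · have := hsep l k n m h1 hm hmn
      omega
  · intro q hq
    dsimp only at hq ⊢
    split_ifs at hq ⊢ with h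
    · obtain ⟨h1, h2, h3⟩ := h.choose_spec
      exact ⟨_, _, q - h.choose.2, h1, by omega, by omega, rfl⟩
    · exact absurd rfl hq

/-- With `y` the planted sequence and `x = v * y`, shifting by `m ∈ A k` reproduces `v * z k` on
`[0, k]`. The error beyond lives on `G h`, where one extra factor `exp (α n)` absorbs the pattern
entries and leaves a factor `1 / k`. -/
theorem isFrequentlyHypercyclic_of_visits (hL : IsSolidGauge L) (hX : IsGaugeSpace L α 𝕜 X)
    (hmono : Monotone α) (hlim : Tendsto α atTop atTop)
    (hv : ∀ n, 0 < v n) {T : X →L[𝕜] X}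
    (hT : ∀ (x : X) n, T x n = ((v n / v (n + 1) : ℝ) : 𝕜) * x (n + 1))
    {G A : ℕ → Set ℕ} (hG : Antitone G) (hGlt : ∀ h q, q ∈ G h → h < q)
    (hGexp : ∀ h q, q ∈ G h → (h : ℝ) * h ≤ Real.exp (α q))
    (hGfin : ∀ s : ℝ, ∃ h, L ((G h).indicator fun n => v n * Real.exp (s * α n)) ≠ ⊤)
    (hA : ∀ k, HasPosDensity (A k))
    (hsub : ∀ k l m n i, m ∈ A k → n ∈ A l → m < n → i ≤ l → n - m + i ∈ G (max k l))
    (hdisj : ∀ k l n, n ∈ A k → n ∈ A l → k = l)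
    (hself : ∀ l n i, n ∈ A l → i ≤ l → n + i ∈ G l)
    (htail : ∀ h, ∃ Q, ∀ l n i, n ∈ A l → i ≤ l → Q ≤ n + i → n + i ∈ G h) :
    IsFrequentlyHypercyclic T := by
  obtain ⟨z, hz0, hzb, hz⟩ := exists_recurrent_enumeration 𝕜
  have hsep : ∀ k l m n, m ∈ A k → n ∈ A l → m < n → max k l < n - m :=
    fun k l m n hm hn hmn => hGlt _ _ (hsub k l m n 0 hm hn hmn (Nat.zero_le _))
  obtain ⟨y, hy, hy'⟩ := exists_planted_sequence (z := z) hsep hdisj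
  have hind : ∀ h s n, 0 ≤ (G h).indicator (fun n => v n * Real.exp (s * α n)) n := fun h s n =>
    Set.indicator_nonneg (fun n _ => by have := hv n; positivity) n
  obtain ⟨x, hx⟩ := hX.exists_coe_eq (fun n => (v n : 𝕜) * y n) (by
    intro s
    obtain ⟨h, hh⟩ := hGfin (s + 1)
    obtain ⟨Q, hQ⟩ := htail h
    refine hL.ne_top_of_eventually_le (fun n => by positivity) (hind h (s + 1)) ?_ hh
    filter_upwards [eventually_ge_atTop Q] with q hq
    by_cases hyq : y q = 0
    · simpa [hyq] using hind h (s + 1) q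
    obtain ⟨l, n, i, hn, hi, rfl, hyz⟩ := hy' q hyq
    rw [Set.indicator_of_mem (hQ l n i hn hi hq), hyz, norm_mul, RCLike.norm_ofReal,
      abs_of_pos (hv _), mul_assoc]
    have hvn := hv (n + i)
    gcongr
    rw [add_mul, one_mul, Real.exp_add, mul_comm]
    gcongr
    refine (hzb l i).trans (le_trans ?_ (hGexp l _ (hself l n i hn hi)))
    exact_mod_cast Nat.le_mul_self l)
  refine ⟨x, fun U hU hne => ?_⟩
  obtain ⟨x', hx'U, c, hx'⟩ := exists_simple_mem hL hX hmono hlim hv hU hne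
  obtain ⟨s, ε, hε, hball⟩ := hX.mem_nhds_iff.1 (hU.mem_nhds hx'U)
  obtain ⟨h, hh⟩ := hGfin (s + 1)
  -- Each pattern recurs in the enumeration, so its index `k` may be taken large enough to make the
  -- error small.
  obtain ⟨k, hk, hkε, hkh⟩ := ((hz c).and_eventually ((eventually_ofReal_mul_lt
    (tendsto_one_div_atTop_nhds_zero_nat (𝕜 := ℝ)) hh hε).and (eventually_ge_atTop (h + 1)))).exists
  refine ((hA k).mono fun m hm => ?_).lowerDensity_pos
  refine hball _ (lt_of_le_of_lt ?_ hkε)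
  refine (hL.mono (fun n => by positivity) fun n => ?_).trans
    (hL.const_mul_le (by positivity) (hind h (s + 1)))
  have hdiff : (T^[m] x - x') n = (v n : 𝕜) * (y (m + n) - z k n) := by
    have : (v (n + m) : 𝕜) ≠ 0 := RCLike.ofReal_ne_zero.2 (hv _).ne'
    rw [hX.sub_apply, iterate_shift_apply hv hT, hx, hx', hk, add_comm m n, RCLike.ofReal_div]
    field_simp
  have hvn := hv n
  rw [hdiff, norm_mul, RCLike.norm_ofReal, abs_of_pos hvn]
  have hrhs : 0 ≤ 1 / (k : ℝ) *
      (G h).indicator (fun n => v n * Real.exp ((s + 1) * α n)) n :=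
    mul_nonneg (by positivity) (hind h (s + 1) n)
  rcases le_or_gt n k with hnk | hnk
  · simpa [hy k m n hm hnk] using hrhs
  rw [hz0 k n hnk, sub_zero]
  by_cases hyq : y (m + n) = 0
  · simpa [hyq] using hrhs
  obtain ⟨l, n', i, hn', hi, heq, hyz⟩ := hy' _ hyq
  have hlt : m < n' := by
    rcases lt_trichotomy m n' with h1 | rfl | h1
    · exact h1
    · have := hdisj k l m hm hn'
      omega
    · have := hsep l k n' m hn' hm h1
      omega
  have hnG := hsub k l m n' i hm hn' hlt hi
  have hn : n' - m + i = n := by omega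
  rw [hn] at hnG
  rw [Set.indicator_of_mem (hG (by omega : h ≤ max k l) hnG), hyz]
  have hk0 : (0 : ℝ) < k := by exact_mod_cast (by omega : 0 < k)
  -- Both factors are at most `max k l`, whose square is at most `exp (α n)` on `G (max k l)`.
  have h1 : ‖z l i‖ * k ≤ Real.exp (α n) := by
    refine le_trans ?_ (hGexp _ _ hnG)
    have h2 : (l : ℝ) ≤ (max k l : ℕ) := by exact_mod_cast le_max_right k l
    have h3 : (k : ℝ) ≤ (max k l : ℕ) := by exact_mod_cast le_max_left k l
    exact mul_le_mul ((hzb l i).trans h2) h3 hk0.le (by positivity)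
  rw [add_mul, one_mul, Real.exp_add]
  calc v n * ‖z l i‖ * Real.exp (s * α n)
      = 1 / k * (v n * (Real.exp (s * α n) * (‖z l i‖ * k))) := by field_simp
    _ ≤ _ := by gcongr

/-- A finite pattern repeated with large period `q` differs from the pattern only at indices `n ≥
q`, where `exp (-α q)` is gained by raising the exponent by one. -/
theorem dense_periodicPts_shift (hL : IsSolidGauge L) (hX : IsGaugeSpace L α 𝕜 X)
    (hmono : Monotone α) (hlim : Tendsto α atTop atTop) (hv : ∀ n, 0 < v n) {T : X →L[𝕜] X}
    (hT : ∀ (x : X) n, T x n = ((v n / v (n + 1) : ℝ) : 𝕜) * x (n + 1))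
    (hfin : ∀ s : ℝ, L (fun n => v n * Real.exp (s * α n)) ≠ ⊤) :
    Dense (Function.periodicPts T) := by
  refine dense_iff_inter_open.2 fun U hU hne => ?_
  obtain ⟨x', hx'U, c, hx'⟩ := exists_simple_mem hL hX hmono hlim hv hU hne
  obtain ⟨s, ε, hε, hball⟩ := hX.mem_nhds_iff.1 (hU.mem_nhds hx'U)
  obtain ⟨N, hN⟩ := eventually_simpleSeq_eq_zero 𝕜 c
  obtain ⟨C, hC⟩ := exists_bound_simpleSeq 𝕜 c
  have hC0 : 0 ≤ C := (norm_nonneg _).trans (hC 0)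
  have hlim' : Tendsto (fun n => C * Real.exp (-α n)) atTop (𝓝 0) := by
    simpa using (tendsto_exp_neg_comp hlim).const_mul C
  obtain ⟨q, hq, hqN⟩ := ((eventually_ofReal_mul_lt hlim' (hfin (s + 1)) hε).and
    (eventually_ge_atTop (N + 1))).exists
  obtain ⟨x, hx⟩ := hX.exists_coe_eq (fun n => (v n : 𝕜) * simpleSeq 𝕜 c (n % q)) fun s =>
    ne_top_of_le_ne_top (ENNReal.mul_ne_top ENNReal.ofReal_ne_top (hfin s))
      ((hL.mono (fun n => by positivity) fun n => by
        have hvn := hv n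
        rw [norm_mul, RCLike.norm_ofReal, abs_of_pos hvn, mul_comm (v n), mul_assoc]
        exact mul_le_mul_of_nonneg_right (hC _) (by positivity)).trans
        (hL.const_mul_le hC0 fun n => by have := hv n; positivity))
  refine ⟨x, hball _ (lt_of_le_of_lt ?_ hq),
    Function.mk_mem_periodicPts (by omega : 0 < q) (DFunLike.ext _ _ fun n => ?_)⟩
  · refine (hL.mono (fun n => by positivity) fun n => ?_).trans
      (hL.const_mul_le (by positivity) fun n => by have := hv n; positivity)
    have hvn := hv n
    rw [hX.sub_apply, hx, hx', ← mul_sub, norm_mul, RCLike.norm_ofReal, abs_of_pos hvn]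
    rcases lt_or_ge n q with h | h
    · rw [Nat.mod_eq_of_lt h]
      simp only [sub_self, norm_zero, mul_zero, zero_mul]
      positivity
    · rw [hN n (by omega), sub_zero]
      have h1 : Real.exp (s * α n) ≤ Real.exp (-α q) * Real.exp ((s + 1) * α n) := by
        rw [← Real.exp_add]
        have := hmono h
        gcongr
        linarith
      calc v n * ‖simpleSeq 𝕜 c (n % q)‖ * Real.exp (s * α n)
          ≤ v n * C * (Real.exp (-α q) * Real.exp ((s + 1) * α n)) := by
            gcongr
            exact hC _
        _ = _ := by ring
  · have hv1 : (v (n + q) : 𝕜) ≠ 0 := RCLike.ofReal_ne_zero.2 (hv _).ne'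
    rw [iterate_shift_apply hv hT, hx, hx, Nat.add_mod_right, RCLike.ofReal_div]
    field_simp

theorem IsGaugeSpace.tendsto_norm_apply (hL : IsSolidGauge L) (hX : IsGaugeSpace L α 𝕜 X)
    (hlim : Tendsto α atTop atTop) (x : X) : Tendsto (fun n => ‖x n‖) atTop (𝓝 0) := by
  have hb : ∀ n, ‖x n‖ * Real.exp (1 * α n) ≤ (weightedGauge L α 1 (x : ℕ → 𝕜)).toReal :=
    fun n => (ENNReal.ofReal_le_iff_le_toReal (hX.gauge_ne_top x 1)).1
      (hL.ofReal_apply_le (a := fun n => ‖x n‖ * Real.exp (1 * α n)) n fun n => by positivity)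
  have hto := (tendsto_exp_neg_comp hlim).const_mul (weightedGauge L α 1 (x : ℕ → 𝕜)).toReal
  rw [mul_zero] at hto
  refine squeeze_zero (fun n => norm_nonneg _) (fun n => ?_) hto
  have := hb n
  rw [one_mul] at this
  rw [Real.exp_neg, ← div_eq_mul_inv, le_div_iff₀ (Real.exp_pos _)]
  exact this

/-- A periodic point with non-zero initial coordinate forces `v` to tend to zero. -/
theorem not_isChaotic_of_frequently (hL : IsSolidGauge L) (hX : IsGaugeSpace L α 𝕜 X)
    (hlim : Tendsto α atTop atTop) (hv : ∀ n, 0 < v n) {T : X →L[𝕜] X}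
    (hT : ∀ (x : X) n, T x n = ((v n / v (n + 1) : ℝ) : 𝕜) * x (n + 1))
    (hfreq : ∃ᶠ n in atTop, v n = 1) : ¬ IsChaotic T := by
  rintro ⟨-, hdense⟩
  obtain ⟨e, he⟩ := hX.exists_coe_eq (fun n => if n = 0 then (1 : 𝕜) else 0) fun s =>
    hL.ne_top_of_eventually_eq_zero (fun n => by positivity) (N := 1) fun n hn => by
      have : n ≠ 0 := by omega
      simp [this]
  have hmem : {x : X | x 0 ≠ 0} ∈ 𝓝 e := by
    refine hX.mem_nhds_iff.2 ⟨0, 1, one_pos, fun y hy h0 => hy.not_ge ?_⟩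
    refine le_trans ?_ (hL.ofReal_apply_le 0 fun n => by positivity)
    replace h0 : y 0 = 0 := h0
    simp [hX.sub_apply, he, h0]
  obtain ⟨x, hxp, hx0⟩ := hdense.inter_nhds_nonempty hmem
  obtain ⟨q, hq, hper⟩ := hxp
  have hx0' : 0 < ‖x 0‖ := norm_pos_iff.2 hx0
  -- Periodicity ties coordinate `n + i` of `x` to `x 0`. The points `T^[i] x` with `i < q` cover
  -- all residue classes of `n`, so the indices with `v n = 1` need not lie in any particular class.
  have hval : ∀ n i, q ∣ n + i → ‖T^[i] x n‖ = v n / v 0 * ‖x 0‖ := by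
    intro n i hd
    have h1 : T^[n + i] x = x := (hper.trans_dvd hd).eq
    have h2 := congrArg (fun y : X => y 0) h1
    simp only [iterate_shift_apply hv hT, zero_add] at h2
    rw [iterate_shift_apply hv hT, ← h2, norm_mul, norm_mul, RCLike.norm_ofReal,
      RCLike.norm_ofReal, abs_of_pos (div_pos (hv _) (hv _)), abs_of_pos (div_pos (hv _) (hv _))]
    have := (hv 0).ne'
    field_simp
  have hev : ∀ᶠ n in atTop, ∀ i ∈ Finset.range q, ‖T^[i] x n‖ < 1 / v 0 * ‖x 0‖ :=
    (Finset.eventually_all _).2 fun i _ =>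
      (hX.tendsto_norm_apply hL hlim (T^[i] x)).eventually_lt_const
        (mul_pos (one_div_pos.2 (hv 0)) hx0')
  obtain ⟨n, hn, hlt⟩ := (hfreq.and_eventually hev).exists
  have hmod := Nat.mod_lt n hq
  rcases Nat.eq_zero_or_pos (n % q) with h0 | h0
  · have := hlt 0 (Finset.mem_range.2 hq)
    rw [hval n 0 (Nat.dvd_of_mod_eq_zero h0), hn] at this
    exact lt_irrefl _ this
  · have := hlt (q - n % q) (Finset.mem_range.2 (by omega))
    rw [hval n _ ⟨n / q + 1, by
      rw [mul_add, mul_one]; have := Nat.div_add_mod n q; omega⟩, hn] at this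
    exact lt_irrefl _ this

end GaugeSpace

/-! ### Restarted partial sums. -/

open Classical in
/-- The partial sums of `α`, restarted from zero at each element of `S`. -/
def resetSum (S : Set ℕ) (α : ℕ → ℝ) : ℕ → ℝ
  | 0 => 0
  | n + 1 => if n + 1 ∈ S then 0 else resetSum S α n + α n

section ResetSum

variable {S : Set ℕ} {α : ℕ → ℝ}

theorem resetSum_of_mem {n : ℕ} (hn : n ∈ S) : resetSum S α n = 0 := by
  cases n with
  | zero => rfl
  | succ n => exact if_pos hn

theorem resetSum_succ_of_notMem {n : ℕ} (hn : n + 1 ∉ S) :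
    resetSum S α (n + 1) = resetSum S α n + α n :=
  if_neg hn

theorem resetSum_nonneg (hpos : ∀ n, 0 < α n) (n : ℕ) : 0 ≤ resetSum S α n := by
  induction n with
  | zero => exact le_rfl
  | succ n ih =>
    by_cases h : n + 1 ∈ S
    · exact (resetSum_of_mem h).ge
    · rw [resetSum_succ_of_notMem h]
      exact add_nonneg ih (hpos n).le

theorem resetSum_succ_le (hpos : ∀ n, 0 < α n) (n : ℕ) :
    resetSum S α (n + 1) ≤ resetSum S α n + α n := by
  by_cases h : n + 1 ∈ S
  · rw [resetSum_of_mem h]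
    exact add_nonneg (resetSum_nonneg hpos n) (hpos n).le
  · exact (resetSum_succ_of_notMem h).le

theorem le_of_mem_gapSet (h0 : 0 ∈ S) {j q : ℕ} (hq : q ∈ gapSet S j) : j ≤ q := by
  simpa using hq 0 h0 (Nat.zero_le q)

/-- No restart occurs among the last `j` indices, so the last `j` summands are all still present. -/
theorem windowSum_le_resetSum (hpos : ∀ n, 0 < α n) (h0 : 0 ∈ S) {j q : ℕ}
    (hq : q ∈ gapSet S j) : windowSum α j q ≤ resetSum S α q := by
  induction j generalizing q with
  | zero => simpa [windowSum] using resetSum_nonneg hpos q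
  | succ j ih =>
    have hjq := le_of_mem_gapSet h0 hq
    obtain ⟨q, rfl⟩ : ∃ q', q = q' + 1 := ⟨q - 1, by omega⟩
    have hS : q + 1 ∉ S := fun h => by
      have := hq _ h le_rfl
      omega
    have hq' : q ∈ gapSet S j := fun s hs hsq => by
      have := hq s hs (by omega)
      omega
    rw [resetSum_succ_of_notMem hS, windowSum, Nat.add_sub_add_right,
      Finset.sum_Ico_succ_top (Nat.sub_le q j)]
    exact add_le_add (ih hq') le_rfl

/-- Off `S` each term is at most `θ = exp (-c * α 0) < 1` times the previous one, except just after
a restart, where it is `exp (-c * α n)` with `n ∈ S`. Sparsity makes these new starts summable. -/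
theorem summable_exp_neg_resetSum (hpos : ∀ n, 0 < α n) (hmono : Monotone α) (h0 : 0 ∈ S)
    {c : ℝ} (hc : 0 < c) (hS : Summable (S.indicator fun n => Real.exp (-c * α n))) :
    Summable (Sᶜ.indicator fun n => Real.exp (-c * resetSum S α n)) := by
  classical
  set f := Sᶜ.indicator fun n => Real.exp (-c * resetSum S α n) with hf
  set g := S.indicator fun n => Real.exp (-c * α n) with hg
  set θ := Real.exp (-c * α 0) with hθ
  have hf0 : ∀ n, 0 ≤ f n := fun n => Set.indicator_nonneg (fun n _ => (Real.exp_pos _).le) n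
  have hg0 : ∀ n, 0 ≤ g n := fun n => Set.indicator_nonneg (fun n _ => (Real.exp_pos _).le) n
  have hθ0 : 0 < θ := Real.exp_pos _
  have hθ1 : θ < 1 := Real.exp_zero ▸ Real.exp_lt_exp.2 (by nlinarith [hpos 0])
  have hstep : ∀ n, f (n + 1) ≤ g n + θ * f n := by
    intro n
    by_cases h1 : n + 1 ∈ S
    · rw [hf, Set.indicator_of_notMem (Set.notMem_compl_iff.2 h1)]
      exact add_nonneg (hg0 n) (mul_nonneg hθ0.le (hf0 n))
    have hfn : f (n + 1) = Real.exp (-c * resetSum S α n) * Real.exp (-c * α n) := by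
      rw [hf, Set.indicator_of_mem (Set.mem_compl h1), resetSum_succ_of_notMem h1, mul_add,
        Real.exp_add]
    rw [hfn]
    by_cases h2 : n ∈ S
    · have : g n = Real.exp (-c * α n) := Set.indicator_of_mem h2 _
      rw [resetSum_of_mem h2, this]
      simpa using mul_nonneg hθ0.le (hf0 n)
    · have : f n = Real.exp (-c * resetSum S α n) := Set.indicator_of_mem (Set.mem_compl h2) _
      rw [this, mul_comm θ]
      have h3 : Real.exp (-c * α n) ≤ θ := by
        have := hmono (Nat.zero_le n)
        exact Real.exp_le_exp.2 (by nlinarith)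
      exact (mul_le_mul_of_nonneg_left h3 (Real.exp_pos _).le).trans
        (le_add_of_nonneg_left (hg0 n))
  -- The bound is the fixed point of `σ ↦ ∑' n, g n + θ * σ`, so it propagates by induction.
  refine summable_of_sum_range_le (c := (∑' n, g n) / (1 - θ)) hf0 fun n => ?_
  have hσ : 0 ≤ ∑' n, g n := tsum_nonneg hg0
  induction n with
  | zero =>
    have : 0 < 1 - θ := by linarith
    simpa using div_nonneg hσ this.le
  | succ n ih =>
    have hfz : f 0 = 0 := Set.indicator_of_notMem (Set.notMem_compl_iff.2 h0) _
    rw [Finset.sum_range_succ', hfz, add_zero]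
    calc ∑ i ∈ Finset.range n, f (i + 1) ≤ ∑ i ∈ Finset.range n, (g i + θ * f i) :=
          Finset.sum_le_sum fun i _ => hstep i
      _ = ∑ i ∈ Finset.range n, g i + θ * ∑ i ∈ Finset.range n, f i := by
          rw [Finset.sum_add_distrib, Finset.mul_sum]
      _ ≤ (∑' n, g n) + θ * ((∑' n, g n) / (1 - θ)) := by
          gcongr
          exact hS.sum_le_tsum _ fun i _ => hg0 i
      _ = _ := by
          have : 1 - θ ≠ 0 := by linarith
          field_simp
          ring

end ResetSum

/-! ### From decay to the two shifts. -/

/-- `S` contains `0` and is so sparse that `∑_{n ∈ S} e^{-c α_n}` converges for all `c > 0`. -/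
def IsSparse (α : ℕ → ℝ) (S : Set ℕ) : Prop :=
  0 ∈ S ∧ ∀ c : ℝ, 0 < c → Summable (S.indicator fun n => Real.exp (-c * α n))

theorem isSparse_singleton (α : ℕ → ℝ) : IsSparse α {0} :=
  ⟨rfl, fun c _ => summable_of_ne_finset_zero (s := {0}) fun n hn =>
    Set.indicator_of_notMem (by simpa using hn) _⟩

theorem isSparse_restartSet {α : ℕ → ℝ} {a : ℕ → ℕ} (ha : Function.Injective a)
    (hα : ∀ r : ℕ, (r : ℝ) ≤ α (a r)) : IsSparse α (restartSet a) := by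
  refine ⟨Set.mem_insert _ _, fun c hc => ?_⟩
  have h1 : Summable ((Set.range a).indicator fun n => Real.exp (-c * α n)) := by
    rw [← ha.summable_iff fun x hx => Set.indicator_of_notMem hx _]
    refine Summable.of_nonneg_of_le (fun r => ?_) (fun r => ?_)
      (Real.summable_exp_nat_mul_iff.2 (neg_lt_zero.2 hc))
    · exact Set.indicator_nonneg (fun n _ => (Real.exp_pos _).le) _
    · rw [Function.comp_apply, Set.indicator_of_mem (Set.mem_range_self r)]
      refine Real.exp_le_exp.2 ?_
      nlinarith [hα r]
  refine h1.of_norm_bounded_eventually_nat ?_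
  filter_upwards [eventually_ge_atTop 1] with n hn
  by_cases h : n ∈ Set.range a
  · rw [Set.indicator_of_mem h, Set.indicator_of_mem (show n ∈ restartSet a from Set.mem_insert_of_mem _ h),
      Real.norm_eq_abs,
      abs_of_pos (Real.exp_pos _)]
  · rw [Set.indicator_of_notMem h, Set.indicator_of_notMem, norm_zero]
    rintro (h' | h')
    · omega
    · exact h h'

/-- Off a neighbourhood to the right of `S`, of a size that depends only on the seminorm, the
weights `e^{-K u_n}`, with `u` the reset sums of `α`, have finite gauge. -/
def HasDecay (L : (ℕ → ℝ) → ℝ≥0∞) (α : ℕ → ℝ) (K : ℝ) : Prop :=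
  ∀ s : ℝ, ∃ j : ℕ, ∀ S, IsSparse α S → L ((gapSet S j).indicator fun n =>
    Real.exp (-K * resetSum S α n) * Real.exp (s * α n)) ≠ ⊤

theorem exists_widths {α : ℕ → ℝ} (hlim : Tendsto α atTop atTop) (J : ℕ → ℕ) :
    ∃ w : ℕ → ℕ, Monotone w ∧ (∀ h, h < w h) ∧ ∀ h q, w h ≤ q →
      J h ≤ q ∧ (h : ℝ) * h ≤ Real.exp (α q) ∧ (h : ℝ) ≤ α q := by
  have hev : ∀ h : ℕ, ∃ b, ∀ q, b ≤ q →
      J h ≤ q ∧ (h : ℝ) * h ≤ Real.exp (α q) ∧ (h : ℝ) ≤ α q := fun h =>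
    eventually_atTop.1 ((eventually_ge_atTop (J h)).and
      (((Real.tendsto_exp_atTop.comp hlim).eventually_ge_atTop _).and
        (hlim.eventually_ge_atTop _)))
  choose b hb using hev
  refine ⟨fun h => ∑ i ∈ Finset.range (h + 1), (b i + 1), ?_, fun h => ?_, fun h q hq => ?_⟩
  · exact monotone_nat_of_le_succ fun h => by
      rw [Finset.sum_range_succ _ (h + 1)]
      omega
  · calc h < ∑ i ∈ Finset.range (h + 1), 1 := by simp
      _ ≤ _ := Finset.sum_le_sum fun i _ => by omega
  · refine hb h q (le_trans ?_ hq)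
    dsimp only
    rw [Finset.sum_range_succ]
    omega

theorem supports_of_hasDecay {𝕜 X : Type*} [RCLike 𝕜] [AddCommGroup X] [Module 𝕜 X]
    [TopologicalSpace X] [FunLike X ℕ 𝕜] {L : (ℕ → ℝ) → ℝ≥0∞} {α : ℕ → ℝ}
    (hL : IsSolidGauge L) (hX : IsGaugeSpace L α 𝕜 X) (hpos : ∀ n, 0 < α n) (hmono : Monotone α)
    (hlim : Tendsto α atTop atTop) {K : ℝ} (hK : 0 < K) (hdecay : HasDecay L α K) :
    SupportsChaoticShift 𝕜 X ∧ SupportsNonChaoticFHCShift 𝕜 X := by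
  -- The widths `J` do not depend on `S`; this lets the restart set be built from them without
  -- circularity.
  choose J hJ using hdecay
  obtain ⟨w, hwm, hwlt, hw⟩ := exists_widths hlim fun h => J h
  obtain ⟨a, P, H⟩ := exists_isScale hwm hwlt
  let v : Set ℕ → ℕ → ℝ := fun S n => Real.exp (-K * resetSum S α n)
  have hv : ∀ S n, 0 < v S n := fun S n => Real.exp_pos _
  have hshift : ∀ S, ∃ T : X →L[𝕜] X, IsWeightedShift T (weightOf 𝕜 (v S)) ∧
      ∀ (x : X) n, T x n = ((v S n / v S (n + 1) : ℝ) : 𝕜) * x (n + 1) := fun S =>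
    exists_weightedShift hL hX hpos hmono (hv S) (K := K) fun n => by
      rw [← Real.exp_add]
      refine Real.exp_le_exp.2 ?_
      nlinarith [resetSum_succ_le (S := S) hpos n]
  have hfhc : ∀ S, IsSparse α S → S ⊆ restartSet a → ∀ T : X →L[𝕜] X,
      (∀ (x : X) n, T x n = ((v S n / v S (n + 1) : ℝ) : 𝕜) * x (n + 1)) →
      IsFrequentlyHypercyclic T := by
    intro S hS hsub T hT
    have hmem : ∀ {j q}, q ∈ gapSet (restartSet a) j → q ∈ gapSet S j :=
      fun hq => gapSet_anti_left hsub _ hq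
    refine isFrequentlyHypercyclic_of_visits hL hX hmono hlim (hv S) hT
      (G := fun h => gapSet S (w h)) (A := visitSet w a P)
      (fun h k hhk => gapSet_antitone S (hwm hhk))
      (fun h q hq => (hwlt h).trans_le (le_of_mem_gapSet hS.1 hq))
      (fun h q hq => (hw h q (le_of_mem_gapSet hS.1 hq)).2.1) (fun s => ?_)
      H.visitSet_hasPosDensity
      (fun k l m n i hm hn hmn hi => hmem (H.visitSet_sub_mem_gapSet hm hn hmn hi))
      (fun k l n => visitSet_disjoint)
      (fun l n i hn hi => hmem (H.visitSet_add_mem_gapSet hn hi))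
      (fun h => ⟨_, fun l n i hn hi hq => hmem (H.visitSet_eventually_mem_gapSet hn hi hq)⟩)
    -- Natural exponents suffice, since weights increase with `s`; the width `w h` dominates `J h`.
    obtain ⟨h, hh⟩ := exists_nat_ge s
    refine ⟨h, ne_top_of_le_ne_top (hJ h S hS) (hL.mono
      (fun n => Set.indicator_nonneg (fun n _ => by positivity) n) fun n => ?_)⟩
    refine Set.indicator_le_indicator_of_subset
      (gapSet_antitone S (hw h (w h) le_rfl).1) (fun n => by positivity) n |>.trans ?_
    refine Set.indicator_le_indicator ?_
    have := (hpos n).le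
    dsimp only [v]
    gcongr
  constructor
  · obtain ⟨T, hTw, hT⟩ := hshift {0}
    refine ⟨T, _, hTw, (hfhc {0} (isSparse_singleton α)
      (Set.singleton_subset_iff.2 (Set.mem_insert _ _)) T hT).isHypercyclic,
      dense_periodicPts_shift hL hX hmono hlim (hv {0}) hT fun s => ?_⟩
    refine hL.ne_top_of_eventually_le (fun n => by positivity)
      (fun n => Set.indicator_nonneg (fun n _ => by positivity) n) ?_
      (hJ s {0} (isSparse_singleton α))
    filter_upwards [eventually_ge_atTop (J s)] with n hn
    rw [Set.indicator_of_mem]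
    rintro i rfl -
    simpa using hn
  · have hsparse : IsSparse α (restartSet a) := isSparse_restartSet H.a_strictMono.injective
      fun r => (hw r (a r) (H.w_le_a r)).2.2
    obtain ⟨T, hTw, hT⟩ := hshift (restartSet a)
    refine ⟨T, _, hTw, hfhc _ hsparse le_rfl T hT,
      not_isChaotic_of_frequently hL hX hlim (hv _) hT (frequently_atTop.2 fun b =>
        ⟨a b, H.a_strictMono.le_apply, ?_⟩)⟩
    simp [v, resetSum_of_mem (show a b ∈ restartSet a from Set.mem_insert_of_mem _ ⟨b, rfl⟩)]

/-! ### Power series spaces as gauge spaces. -/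

/-- The `ℓ^p`-norm. -/
def lpGauge (p : ℝ) (a : ℕ → ℝ) : ℝ≥0∞ := (∑' n, ENNReal.ofReal (a n) ^ p) ^ (1 / p)

/-- The supremum norm. -/
def supGauge (a : ℕ → ℝ) : ℝ≥0∞ := ⨆ n, ENNReal.ofReal (a n)

theorem lpGauge_eq_ofReal {p : ℝ} (hp : 1 ≤ p) {a : ℕ → ℝ} (ha : ∀ n, 0 ≤ a n)
    (hs : Summable fun n => a n ^ p) :
    lpGauge p a = ENNReal.ofReal ((∑' n, a n ^ p) ^ (1 / p)) := by
  have hp0 : 0 ≤ p := by linarith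
  rw [lpGauge, ← ENNReal.ofReal_rpow_of_nonneg
    (tsum_nonneg fun n => Real.rpow_nonneg (ha n) p) (by positivity),
    ENNReal.ofReal_tsum_of_nonneg (fun n => Real.rpow_nonneg (ha n) p) hs]
  simp only [ENNReal.ofReal_rpow_of_nonneg (ha _) hp0]

theorem lpGauge_ne_top_iff {p : ℝ} (hp : 1 ≤ p) {a : ℕ → ℝ} (ha : ∀ n, 0 ≤ a n) :
    lpGauge p a ≠ ⊤ ↔ Summable fun n => a n ^ p := by
  have hp0 : 0 < p := by linarith
  refine ⟨fun h => ?_, fun h => by rw [lpGauge_eq_ofReal hp ha h]; exact ENNReal.ofReal_ne_top⟩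
  have h1 : ∑' n, ENNReal.ofReal (a n) ^ p ≠ ⊤ := fun h' => h (by
    rw [lpGauge, h', ENNReal.top_rpow_of_pos (by positivity)])
  refine (ENNReal.summable_toReal h1).congr fun n => ?_
  rw [← ENNReal.toReal_rpow, ENNReal.toReal_ofReal (ha n)]

theorem isSolidGauge_lpGauge {p : ℝ} (hp : 1 ≤ p) : IsSolidGauge (lpGauge p) := by
  have hp0 : 0 < p := by linarith
  refine ⟨fun {a b} _ hab => ?_, fun {c a} hc ha => ?_, fun {a} ha => ?_, fun {a} n ha => ?_,
    fun {a b} ha hb hab h => ?_, ?_⟩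
  · unfold lpGauge
    gcongr with n
    exact hab n
  · unfold lpGauge
    simp only [ENNReal.ofReal_mul hc, ENNReal.mul_rpow_of_nonneg _ _ hp0.le]
    rw [ENNReal.tsum_mul_left, ENNReal.mul_rpow_of_nonneg _ _ (by positivity), ← ENNReal.rpow_mul,
      mul_one_div_cancel hp0.ne', ENNReal.rpow_one]
  · unfold lpGauge
    exact ENNReal.rpow_le_rpow (ENNReal.tsum_comp_le_tsum_of_injective (add_left_injective 1)
      fun n => ENNReal.ofReal (a n) ^ p) (by positivity)
  · calc ENNReal.ofReal (a n) = (ENNReal.ofReal (a n) ^ p) ^ (1 / p) := by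
          rw [← ENNReal.rpow_mul, mul_one_div_cancel hp0.ne', ENNReal.rpow_one]
      _ ≤ _ := by
          unfold lpGauge
          gcongr
          exact ENNReal.le_tsum (f := fun n => ENNReal.ofReal (a n) ^ p) n
  · rw [lpGauge_ne_top_iff hp hb] at h
    rw [lpGauge_ne_top_iff hp ha]
    refine h.of_norm_bounded_eventually_nat (hab.mono fun n hn => ?_)
    rw [Real.norm_of_nonneg (Real.rpow_nonneg (ha n) p)]
    exact Real.rpow_le_rpow (ha n) hn hp0.le
  · rw [lpGauge_ne_top_iff hp fun _ => le_rfl]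
    simp [Real.zero_rpow hp0.ne']

theorem isSolidGauge_supGauge : IsSolidGauge supGauge := by
  refine ⟨fun {a b} _ hab => iSup_mono fun n => ENNReal.ofReal_le_ofReal (hab n),
    fun {c a} hc ha => ?_, fun {a} ha => ?_, fun {a} n ha => ?_,
    fun {a b} ha hb hab h => ?_, by simp [supGauge]⟩
  · simp only [supGauge, ENNReal.ofReal_mul hc, ENNReal.mul_iSup, le_refl]
  · exact iSup_le fun n => le_iSup (fun n => ENNReal.ofReal (a n)) (n + 1)
  · exact le_iSup (fun n => ENNReal.ofReal (a n)) n
  · obtain ⟨N, hN⟩ := eventually_atTop.1 hab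
    refine ne_top_of_le_ne_top (ENNReal.add_ne_top.2 ⟨h, ENNReal.sum_ne_top.2
      fun n (_ : n ∈ Finset.range N) => ENNReal.ofReal_ne_top (r := a n)⟩) (iSup_le fun n => ?_)
    rcases lt_or_ge n N with hn | hn
    · exact (Finset.single_le_sum (f := fun n => ENNReal.ofReal (a n)) (fun _ _ => zero_le)
        (Finset.mem_range.2 hn)).trans le_add_self
    · exact (ENNReal.ofReal_le_ofReal (hN n hn)).trans
        ((le_iSup (fun n => ENNReal.ofReal (b n)) n).trans le_self_add)

theorem WithSeminorms.mem_nhds_iff_of_monotone {𝕜 X : Type*} [RCLike 𝕜] [AddCommGroup X]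
    [Module 𝕜 X] [TopologicalSpace X] {q : ℝ → Seminorm 𝕜 X} (hq : WithSeminorms q)
    (hmono : Monotone q) {x : X} {U : Set X} :
    U ∈ 𝓝 x ↔ ∃ t r : ℝ, 0 < r ∧ ∀ y, q t (y - x) < r → y ∈ U := by
  rw [hq.mem_nhds_iff]
  constructor
  · rintro ⟨s, r, hr, hsub⟩
    obtain ⟨t, ht⟩ := s.bddAbove
    refine ⟨t, r, hr, fun y hy => hsub ?_⟩
    rw [Seminorm.mem_ball]
    exact lt_of_le_of_lt (Finset.sup_le (fun i hi => hmono (ht hi)) (y - x)) hy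
  · rintro ⟨t, r, hr, hsub⟩
    refine ⟨{t}, r, hr, fun y hy => hsub y ?_⟩
    rwa [Finset.sup_singleton, Seminorm.mem_ball] at hy

/-- The factor `p` reflects that the `ℓ^p` gauge puts the exponential weight inside the `p`-th
power, whereas the seminorm puts it outside. -/
theorem exists_gauge_ball_iff {X : Type*} [AddCommGroup X] {q : ℝ → X → ℝ} {g : ℝ → X → ℝ≥0∞}
    {p : ℝ} (hp : p ≠ 0) (hg : ∀ s x, g s x = ENNReal.ofReal (q (p * s) x))
    (x : X) (U : Set X) :
    (∃ t r : ℝ, 0 < r ∧ ∀ y, q t (y - x) < r → y ∈ U) ↔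
      ∃ s : ℝ, ∃ ε : ℝ≥0∞, 0 < ε ∧ ∀ y, g s (y - x) < ε → y ∈ U := by
  constructor
  · rintro ⟨t, r, hr, h⟩
    refine ⟨t / p, ENNReal.ofReal r, ENNReal.ofReal_pos.2 hr, fun y hy => h y ?_⟩
    rw [hg, mul_div_cancel₀ _ hp] at hy
    exact (ENNReal.ofReal_lt_ofReal_iff hr).1 hy
  · rintro ⟨s, ε, hε, h⟩
    obtain ⟨r, hr, hrε⟩ := exists_pos_ofReal_mul_lt ENNReal.one_ne_top hε
    rw [mul_one] at hrε
    refine ⟨p * s, r, hr, fun y hy => h y ?_⟩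
    rw [hg]
    exact (ENNReal.ofReal_le_ofReal hy.le).trans_lt hrε

theorem mul_exp_rpow {b p : ℝ} (hb : 0 ≤ b) (s c : ℝ) :
    (b * Real.exp (s * c)) ^ p = b ^ p * Real.exp (p * s * c) := by
  rw [Real.mul_rpow hb (Real.exp_pos _).le, ← Real.exp_mul]
  ring_nf

section Spaces

variable {𝕜 : Type*} [RCLike 𝕜] {α : ℕ → ℝ}

theorem Lambda.seminorm_apply {p : ℝ} [Fact (1 ≤ p)] (t : ℝ) (x : Lambda 𝕜 p α) :
    Lambda.seminorm t x = (∑' n, ‖x n‖ ^ p * Real.exp (t * α n)) ^ (1 / p) := rfl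

theorem Lambda.summable {p : ℝ} [Fact (1 ≤ p)] (x : Lambda 𝕜 p α) (t : ℝ) :
    Summable fun n => ‖x n‖ ^ p * Real.exp (t * α n) := x.2 t

theorem Lambda.seminorm_mono {p : ℝ} [hp : Fact (1 ≤ p)] (hpos : ∀ n, 0 < α n) :
    Monotone fun t : ℝ => (Lambda.seminorm t : Seminorm 𝕜 (Lambda 𝕜 p α)) := by
  intro t t' h x
  have hp0 : 0 < p := by linarith [hp.out]
  dsimp only
  rw [Lambda.seminorm_apply, Lambda.seminorm_apply]
  refine Real.rpow_le_rpow (tsum_nonneg fun n => by positivity) ?_ (by positivity)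
  refine (x.summable t).tsum_le_tsum (fun n => ?_) (x.summable t')
  have := (hpos n).le
  gcongr

theorem Lambda.weightedGauge_eq {p : ℝ} [hp : Fact (1 ≤ p)] (s : ℝ) (x : Lambda 𝕜 p α) :
    weightedGauge (lpGauge p) α s (x : ℕ → 𝕜) =
      ENNReal.ofReal (Lambda.seminorm (p * s) x) := by
  have h : ∀ n, (‖x n‖ * Real.exp (s * α n)) ^ p = ‖x n‖ ^ p * Real.exp (p * s * α n) :=
    fun n => mul_exp_rpow (norm_nonneg _) _ _
  rw [weightedGauge, lpGauge_eq_ofReal hp.out (fun n => by positivity)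
    (by simpa only [h] using x.summable (p * s)), Lambda.seminorm_apply]
  simp only [h]

theorem Lambda.isGaugeSpace {p : ℝ} [hp : Fact (1 ≤ p)] (hpos : ∀ n, 0 < α n) :
    IsGaugeSpace (lpGauge p) α 𝕜 (Lambda 𝕜 p α) := by
  have hp0 : p ≠ 0 := by linarith [hp.out]
  refine ⟨fun x y n => rfl, fun x y n => rfl, fun c x n => rfl, fun x s => ?_, fun f hf => ?_,
    fun {x U} => ?_⟩
  · rw [Lambda.weightedGauge_eq]
    exact ENNReal.ofReal_ne_top
  · refine ⟨⟨f, fun t => ?_⟩, fun n => rfl⟩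
    have := (lpGauge_ne_top_iff hp.out fun n => by positivity).1 (hf (t / p))
    simpa only [mul_exp_rpow (norm_nonneg _), mul_div_cancel₀ _ hp0] using this
  · rw [Lambda.withSeminorms.mem_nhds_iff_of_monotone (Lambda.seminorm_mono hpos)]
    exact exists_gauge_ball_iff hp0
      (g := fun s (x : Lambda 𝕜 p α) => weightedGauge (lpGauge p) α s (x : ℕ → 𝕜))
      (q := fun t x => Lambda.seminorm t x) Lambda.weightedGauge_eq x U

theorem C0Space.seminorm_apply (t : ℝ) (x : C0Space 𝕜 α) :
    C0Space.seminorm t x = ⨆ n, ‖x n‖ * Real.exp (t * α n) := rfl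

theorem C0Space.bddAbove (x : C0Space 𝕜 α) (t : ℝ) :
    BddAbove (Set.range fun n => ‖x n‖ * Real.exp (t * α n)) := weighted_c0_bdd_aux (x.2 t)

theorem C0Space.seminorm_mono (hpos : ∀ n, 0 < α n) :
    Monotone fun t : ℝ => (C0Space.seminorm t : Seminorm 𝕜 (C0Space 𝕜 α)) := by
  intro t t' h x
  refine ciSup_mono (x.bddAbove t') fun n => ?_
  have := (hpos n).le
  gcongr

theorem C0Space.weightedGauge_eq (s : ℝ) (x : C0Space 𝕜 α) :
    weightedGauge supGauge α s (x : ℕ → 𝕜) = ENNReal.ofReal (C0Space.seminorm (1 * s) x) := by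
  rw [one_mul, C0Space.seminorm_apply, weightedGauge, supGauge]
  refine le_antisymm (iSup_le fun n => ENNReal.ofReal_le_ofReal (le_ciSup (x.bddAbove s) n)) ?_
  by_cases h : (⨆ n, ENNReal.ofReal (‖x n‖ * Real.exp (s * α n))) = ⊤
  · rw [h]
    exact le_top
  · refine ENNReal.ofReal_le_of_le_toReal (ciSup_le fun n => ?_)
    exact (ENNReal.ofReal_le_iff_le_toReal h).1
      (le_iSup (fun n => ENNReal.ofReal (‖x n‖ * Real.exp (s * α n))) n)

/-- Boundedness for all exponents already forces convergence to zero for all exponents: the bound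
for `t + 1` leaves a factor `exp (-α n)`. -/
theorem C0Space.isGaugeSpace (hpos : ∀ n, 0 < α n) (hlim : Tendsto α atTop atTop) :
    IsGaugeSpace supGauge α 𝕜 (C0Space 𝕜 α) := by
  refine ⟨fun x y n => rfl, fun x y n => rfl, fun c x n => rfl, fun x s => ?_, fun f hf => ?_,
    fun {x U} => ?_⟩
  · rw [C0Space.weightedGauge_eq]
    exact ENNReal.ofReal_ne_top
  · refine ⟨⟨f, fun t => ?_⟩, fun n => rfl⟩
    have hb : ∀ n, ‖f n‖ * Real.exp ((t + 1) * α n) ≤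
        (weightedGauge supGauge α (t + 1) f).toReal := fun n =>
      (ENNReal.ofReal_le_iff_le_toReal (hf (t + 1))).1
        (le_iSup (fun n => ENNReal.ofReal (‖f n‖ * Real.exp ((t + 1) * α n))) n)
    have hto := (tendsto_exp_neg_comp hlim).const_mul
      (weightedGauge supGauge α (t + 1) f).toReal
    rw [mul_zero] at hto
    refine squeeze_zero (fun n => by positivity) (fun n => ?_) hto
    calc ‖f n‖ * Real.exp (t * α n) = ‖f n‖ * Real.exp ((t + 1) * α n) * Real.exp (-α n) := by
          rw [mul_assoc, ← Real.exp_add]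
          ring_nf
      _ ≤ _ := by
          gcongr
          exact hb n
  · rw [C0Space.withSeminorms.mem_nhds_iff_of_monotone (C0Space.seminorm_mono hpos)]
    exact exists_gauge_ball_iff one_ne_zero
      (g := fun s (x : C0Space 𝕜 α) => weightedGauge supGauge α s (x : ℕ → 𝕜))
      (q := fun t x => C0Space.seminorm t x) C0Space.weightedGauge_eq x U

end Spaces

/-! ### Decay from the growth hypotheses. -/

section Decay

variable {α : ℕ → ℝ}

/-- With `K = -log ε / p`, the `p`-th power of `exp (-K * u)` is `ε ^ u`, so the hypothesis with `C
= (|s| + 1) / K` is a direct majorant. -/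
theorem hasDecay_lpGauge_of_summable {p : ℝ} (hp : 1 ≤ p) (hpos : ∀ n, 0 < α n) {ε : ℝ}
    (hε : 0 < ε) (hε1 : ε < 1)
    (h : ∀ C : ℝ, 0 < C → ∃ j : ℕ, 1 ≤ j ∧
      Summable fun n : {n : ℕ // j ≤ n} => ε ^ (windowSum α j n - C * α n)) :
    ∃ K, 0 < K ∧ HasDecay (lpGauge p) α K := by
  have hp0 : 0 < p := by linarith
  have hlog : Real.log ε < 0 := Real.log_neg hε hε1
  have hK : 0 < -Real.log ε / p := div_pos (neg_pos.2 hlog) hp0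
  refine ⟨-Real.log ε / p, hK, fun s => ?_⟩
  obtain ⟨j, -, hj⟩ := h ((|s| + 1) / (-Real.log ε / p)) (by positivity)
  have hj' := (summable_subtype_iff_indicator (s := {n : ℕ | j ≤ n})
    (f := fun n => ε ^ (windowSum α j n - (|s| + 1) / (-Real.log ε / p) * α n))).1 hj
  refine ⟨j, fun S hS => ?_⟩
  rw [lpGauge_ne_top_iff hp fun n => Set.indicator_nonneg (fun n _ => by positivity) n]
  refine hj'.of_nonneg_of_le (fun n => Real.rpow_nonneg
    (Set.indicator_nonneg (fun n _ => by positivity) n) _) fun n => ?_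
  by_cases hn : n ∈ gapSet S j
  · have hw := windowSum_le_resetSum hpos hS.1 hn
    rw [Set.indicator_of_mem hn,
      Set.indicator_of_mem (show n ∈ {n : ℕ | j ≤ n} from le_of_mem_gapSet hS.1 hn),
      Real.rpow_def_of_pos hε, ← Real.exp_add, ← Real.exp_mul]
    refine Real.exp_le_exp.2 ?_
    have e1 : Real.log ε * (windowSum α j n - (|s| + 1) / (-Real.log ε / p) * α n) =
        Real.log ε * windowSum α j n + p * (|s| + 1) * α n := by
      have := hlog.ne
      field_simp
      ring
    have e2 : (-(-Real.log ε / p) * resetSum S α n + s * α n) * p =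
        Real.log ε * resetSum S α n + p * s * α n := by field_simp
    rw [e1, e2]
    have h1 : Real.log ε * resetSum S α n ≤ Real.log ε * windowSum α j n :=
      mul_le_mul_of_nonpos_left hw hlog.le
    have h2 : p * s * α n ≤ p * (|s| + 1) * α n := by
      have := (hpos n).le
      gcongr
      linarith [le_abs_self s]
    linarith
  · rw [Set.indicator_of_notMem hn, Real.zero_rpow hp0.ne']
    exact Set.indicator_nonneg (fun n _ => by positivity) n

/-- By iterating the ratio limit, `α n ≤ 2 * α (n - j)` eventually, and `α (n - j)` is the smallest
of the `j` summands. -/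
theorem eventually_mul_le_windowSum (hpos : ∀ n, 0 < α n) (hmono : Monotone α)
    (h : Tendsto (fun n => α (n + 1) / α n) atTop (𝓝 1)) (j : ℕ) :
    ∀ᶠ n in atTop, (j : ℝ) / 2 * α n ≤ windowSum α j n := by
  have hj : Tendsto (fun n => α (n + j) / α n) atTop (𝓝 1) := by
    induction j with
    | zero => simp [div_self (hpos _).ne']
    | succ j ih =>
      have := (h.comp (tendsto_add_atTop_nat j)).mul ih
      rw [one_mul] at this
      refine this.congr fun n => ?_
      rw [Function.comp_apply, div_mul_div_cancel₀ (hpos _).ne', add_assoc]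
  obtain ⟨m, hm⟩ := eventually_atTop.1 (hj.eventually_lt_const one_lt_two)
  filter_upwards [eventually_ge_atTop (m + j)] with n hn
  have h1 := hm (n - j) (by omega)
  rw [Nat.sub_add_cancel (by omega), div_lt_iff₀ (hpos _)] at h1
  have h2 : (Finset.Ico (n - j) n).card • α (n - j) ≤ windowSum α j n :=
    Finset.card_nsmul_le_sum _ _ _ fun i hi => hmono (Finset.mem_Ico.1 hi).1
  rw [Nat.card_Ico, nsmul_eq_mul, Nat.sub_sub_self (by omega)] at h2
  have h3 : (j : ℝ) / 2 * α n ≤ (j : ℝ) / 2 * (2 * α (n - j)) := by gcongr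
  linarith

/-- The exponent `-u` is split in halves: one half absorbs `exp (s * α n)` through the window sum,
the other is summable off `S` by sparsity. -/
theorem hasDecay_lpGauge_of_tendsto {p : ℝ} (hp : 1 ≤ p) (hpos : ∀ n, 0 < α n)
    (hmono : Monotone α) (h : Tendsto (fun n => α (n + 1) / α n) atTop (𝓝 1)) :
    HasDecay (lpGauge p) α 1 := by
  have hp0 : 0 < p := by linarith
  intro s
  -- Half of the window sum is at least `j / 4 * α n`, hence the factor 4; the summand 1 ensures `j
  -- ≥ 1`, so that the gap set misses `S`.
  obtain ⟨j, hj⟩ := exists_nat_ge (4 * |s| + 1)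
  have hj1 : 1 ≤ j := by
    exact_mod_cast (by linarith [abs_nonneg s] : (1 : ℝ) ≤ j)
  refine ⟨j, fun S hS => ?_⟩
  have hsum := summable_exp_neg_resetSum hpos hmono hS.1 (half_pos hp0) (hS.2 _ (half_pos hp0))
  have hb : lpGauge p (Sᶜ.indicator fun n => Real.exp (-(1 / 2) * resetSum S α n)) ≠ ⊤ := by
    rw [lpGauge_ne_top_iff hp fun n => Set.indicator_nonneg (fun n _ => by positivity) n]
    refine hsum.congr fun n => ?_
    by_cases hn : n ∈ Sᶜ
    · rw [Set.indicator_of_mem hn, Set.indicator_of_mem hn, ← Real.exp_mul]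
      ring_nf
    · rw [Set.indicator_of_notMem hn, Set.indicator_of_notMem hn, Real.zero_rpow hp0.ne']
  refine (isSolidGauge_lpGauge hp).ne_top_of_eventually_le
    (fun n => Set.indicator_nonneg (fun n _ => by positivity) n)
    (fun n => Set.indicator_nonneg (fun n _ => by positivity) n) ?_ hb
  filter_upwards [eventually_mul_le_windowSum hpos hmono h j] with n hn
  by_cases hg : n ∈ gapSet S j
  · have hnS : n ∈ Sᶜ := fun hnS => by
      have := hg n hnS le_rfl
      omega
    rw [Set.indicator_of_mem hg, Set.indicator_of_mem hnS, ← Real.exp_add]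
    refine Real.exp_le_exp.2 ?_
    have h1 := windowSum_le_resetSum hpos hS.1 hg
    have h2 : s * α n ≤ (j : ℝ) / 4 * α n := by
      have := (hpos n).le
      gcongr
      linarith [le_abs_self s]
    linarith
  · rw [Set.indicator_of_notMem hg]
    exact Set.indicator_nonneg (fun n _ => by positivity) n

theorem hasDecay_supGauge (hpos : ∀ n, 0 < α n)
    (h : ∀ C : ℝ, 0 < C → ∃ j : ℕ, ∃ B : ℝ, ∀ᶠ n in atTop, B ≤ windowSum α j n - C * α n) :
    HasDecay supGauge α 1 := by
  intro s
  obtain ⟨j, B, hB⟩ := h (|s| + 1) (by positivity)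
  refine ⟨j, fun S hS => ?_⟩
  refine isSolidGauge_supGauge.ne_top_of_eventually_le (b := fun _ => Real.exp (-B))
    (fun n => Set.indicator_nonneg (fun n _ => by positivity) n) (fun n => by positivity) ?_
    (by simp [supGauge])
  filter_upwards [hB] with n hn
  by_cases hg : n ∈ gapSet S j
  · rw [Set.indicator_of_mem hg, ← Real.exp_add]
    refine Real.exp_le_exp.2 ?_
    have h1 := windowSum_le_resetSum hpos hS.1 hg
    have h2 : s * α n ≤ (|s| + 1) * α n := by
      have := (hpos n).le
      gcongr
      linarith [le_abs_self s]
    linarith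
  · rw [Set.indicator_of_notMem hg]
    positivity

end Decay

end

theorem theorem4p5 {𝕜 : Type*} [RCLike 𝕜] (α : ℕ → ℝ) (hpos : ∀ n, 0 < α n)
    (hmono : Monotone α) (hlim : Tendsto α atTop atTop) :
    (∀ (p : ℝ) [Fact (1 ≤ p)],
      ((∃ ε : ℝ, 0 < ε ∧ ε < 1 ∧ ∀ C : ℝ, 0 < C → ∃ j : ℕ, 1 ≤ j ∧
          Summable fun n : {n : ℕ // j ≤ n} => ε ^ (windowSum α j n - C * α n)) ∨
        Tendsto (fun n => α (n + 1) / α n) atTop (𝓝 1)) →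
      SupportsChaoticShift 𝕜 (Lambda 𝕜 p α) ∧ SupportsNonChaoticFHCShift 𝕜 (Lambda 𝕜 p α)) ∧
    (((∀ C : ℝ, 0 < C → ∃ j : ℕ, 1 ≤ j ∧
          (⊥ : EReal) < liminf (fun n : ℕ => ((windowSum α j n - C * α n : ℝ) : EReal)) atTop) ∨
        Tendsto (fun n => α (n + 1) / α n) atTop (𝓝 1)) →
      SupportsChaoticShift 𝕜 (C0Space 𝕜 α) ∧ SupportsNonChaoticFHCShift 𝕜 (C0Space 𝕜 α)) := by
  refine ⟨fun p hp h => ?_, fun h => ?_⟩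
  · obtain ⟨K, hK, hdecay⟩ : ∃ K, 0 < K ∧ HasDecay (lpGauge p) α K := by
      rcases h with ⟨ε, hε, hε1, h⟩ | h
      · exact hasDecay_lpGauge_of_summable hp.out hpos hε hε1 h
      · exact ⟨1, one_pos, hasDecay_lpGauge_of_tendsto hp.out hpos hmono h⟩
    exact supports_of_hasDecay (isSolidGauge_lpGauge hp.out) (Lambda.isGaugeSpace hpos) hpos hmono
      hlim hK hdecay
  · refine supports_of_hasDecay isSolidGauge_supGauge (C0Space.isGaugeSpace hpos hlim) hpos hmono
      hlim one_pos (hasDecay_supGauge hpos fun C hC => ?_)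
    rcases h with h | h
    · obtain ⟨j, -, hj⟩ := h C hC
      obtain ⟨B, -, hB⟩ := EReal.lt_iff_exists_real_btwn.1 hj
      exact ⟨j, B, (eventually_lt_of_lt_liminf hB).mono fun n hn => (EReal.coe_lt_coe_iff.1 hn).le⟩
    · obtain ⟨j, hj⟩ := exists_nat_ge (2 * C)
      refine ⟨j, 0, (eventually_mul_le_windowSum hpos hmono h j).mono fun n hn => ?_⟩
      have : C * α n ≤ (j : ℝ) / 2 * α n := by
        have := (hpos n).le
        gcongr
        linarith
      linarith
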